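/- Let $n\ge 1$, $0<s<1<p<\infty$. Let $W^{s,p}(\mathbb R^n)$ be the space of $u\in L^p(\mathbb R^n)$ with $$[u]_{s,p}^p:=\iint_{\mathbb R^n\times\mathbb R^n}\frac{|u(x)-u(y)|^p}{|x-y|^{n+sp}}\,dx\,dy<\infty ,\qquad \|u\|_{s,p}:=\big(\|u\|_{L^p}^p+[u]_{s,p}^p\big)^{1/p},$$ and for an open set $U\subset\mathbb R^n$ let $W^{s,p}_0(U)$ be the closure of $C_c^\infty(U)$ in $W^{s,p}(\mathbb R^n)$. Let $D\subset\mathbb R^n$ be bounded and open, and $f\in W^{-s,p'}(D):=[W^{s,p}_0(D)]'$. For an open set $U\subset D$, the Dirichlet solution $u_U^f$ is the unique $u\in W^{s,p}_0(U)$ such that $$\iint_{\mathbb R^n\times\mathbb R^n}\frac{|u(x)-u(y)|^{p-2}(u(x)-u(y))(v(x)-v(y))}{|x-y|^{n+sp}}\,dx\,dy=\langle f,v\rangle\quad\text{for every } v\in W^{s,p}_0(U).$$ For $E\subset D$ let $$\operatorname{cap}_{s,p}(E;D):=\inf\{[u]_{s,p}^p:\ u\in W^{s,p}_0(D),\ u\ge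 1 \text{ a.e. in an open neighbourhood of } E\},\qquad \inf\emptyset=+\infty .$$ **Theorem.** Let $\Omega_k$ $(k\in\mathbb N)$ and $\Omega$ be open subsets of $D$ such that $\Omega_k\to\Omega$ in the Hausdorff complementary topology, that is, the Hausdorff distance between $\overline D\setminus\Omega_k$ and $\overline D\setminus\Omega$ tends to $0$. Assume that $u_{\Omega_k}^f$ converges weakly in $W^{s,p}_0(D)$ to some $u^*\in W^{s,p}_0(D)$, and that $\operatorname{cap}_{s,p}(\Omega_k\setminus\Omega;D)\to 0$. Then $u_{\Omega_k}^f\rightharpoonup u_\Omega^f$ weakly in $W^{s,p}_0(D)$. -/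

import Mathlib

open MeasureTheory Filter Topology
open scoped ENNReal

noncomputable section

namespace FracSob

/-- `ℝⁿ` with the Euclidean norm. -/
abbrev Rn (n : ℕ) : Type := EuclideanSpace ℝ (Fin n)

/-- The exponent `p` of a Lebesgue space, as an extended nonnegative real. -/
abbrev ex (p : ℝ) : ℝ≥0∞ := ENNReal.ofReal p

instance fact_one_le_ex (p : ℝ) [hp : Fact (1 < p)] : Fact (1 ≤ ex p) :=
  ⟨by simpa [ex] using ENNReal.ofReal_le_ofReal hp.out.le⟩

/-- The difference quotient `(u(x) - u(y)) / |x - y|^(n/p + s)` on `ℝⁿ × ℝⁿ`. -/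
def diffQuot (n : ℕ) (s p : ℝ) (u : Rn n → ℝ) : Rn n × Rn n → ℝ :=
  fun z => (u z.1 - u z.2) / ‖z.1 - z.2‖ ^ ((n : ℝ) / p + s)

/-- The `p`-th power `[u]_{s,p}^p` of the Gagliardo seminorm over `ℝⁿ × ℝⁿ`. -/
def gagliardo (n : ℕ) (s p : ℝ) (u : Rn n → ℝ) : ℝ :=
  ∫ z : Rn n × Rn n, |u z.1 - u z.2| ^ p / ‖z.1 - z.2‖ ^ ((n : ℝ) + s * p)

theorem diffQuot_congr {n : ℕ} {s p : ℝ} {u v : Rn n → ℝ} (h : u =ᵐ[volume] v) :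
    diffQuot n s p u =ᵐ[volume] diffQuot n s p v := by
  have h1 : ∀ᵐ z : Rn n × Rn n, u z.1 = v z.1 :=
    (Measure.quasiMeasurePreserving_fst (μ := (volume : Measure (Rn n)))
      (ν := (volume : Measure (Rn n)))).ae h
  have h2 : ∀ᵐ z : Rn n × Rn n, u z.2 = v z.2 :=
    (Measure.quasiMeasurePreserving_snd (μ := (volume : Measure (Rn n)))
      (ν := (volume : Measure (Rn n)))).ae h
  filter_upwards [h1, h2] with z hz1 hz2
  simp only [diffQuot, hz1, hz2]

theorem diffQuot_add {n : ℕ} {s p : ℝ} (u v : Rn n → ℝ) :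
    diffQuot n s p (u + v) = diffQuot n s p u + diffQuot n s p v := by
  funext z
  simp only [diffQuot, Pi.add_apply]
  ring

theorem diffQuot_smul {n : ℕ} {s p : ℝ} (c : ℝ) (u : Rn n → ℝ) :
    diffQuot n s p (c • u) = c • diffQuot n s p u := by
  funext z
  simp only [diffQuot, Pi.smul_apply, smul_eq_mul]
  ring

/-- `W^{s,p}(ℝⁿ)` as a linear subspace of `L^p(ℝⁿ)`: the `u ∈ L^p(ℝⁿ)` whose difference
quotient is in `L^p(ℝⁿ × ℝⁿ)`. -/
def sobolevSubmodule (n : ℕ) (s p : ℝ) :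
    Submodule ℝ (Lp ℝ (ex p) (volume : Measure (Rn n))) where
  carrier := {u | MemLp (diffQuot n s p u) (ex p) volume}
  zero_mem' := by
    have h : diffQuot n s p ((0 : Lp ℝ (ex p) (volume : Measure (Rn n))) : Rn n → ℝ)
        =ᵐ[volume] (0 : Rn n × Rn n → ℝ) := by
      refine (diffQuot_congr (Lp.coeFn_zero ℝ (ex p) volume)).trans (Eventually.of_forall ?_)
      intro z
      simp [diffQuot]
    exact (memLp_congr_ae h).2 MemLp.zero
  add_mem' := by
    intro u v hu hv
    have h := diffQuot_congr (s := s) (p := p) (Lp.coeFn_add u v)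
    rw [diffQuot_add] at h
    exact (memLp_congr_ae h).2 (MemLp.add hu hv)
  smul_mem' := by
    intro c u hu
    have h := diffQuot_congr (s := s) (p := p) (Lp.coeFn_smul c u)
    rw [diffQuot_smul] at h
    exact (memLp_congr_ae h).2 (MemLp.const_smul hu c)

/-- The fractional Sobolev space `W^{s,p}(ℝⁿ)`. It is a type of its own so that it carries
the norm `‖·‖_{s,p}` and not the norm of `L^p`. -/
def Sobolev (n : ℕ) (s p : ℝ) : Type := ↥(sobolevSubmodule n s p)

instance (n : ℕ) (s p : ℝ) : AddCommGroup (Sobolev n s p) :=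
  inferInstanceAs (AddCommGroup ↥(sobolevSubmodule n s p))

instance (n : ℕ) (s p : ℝ) : Module ℝ (Sobolev n s p) :=
  inferInstanceAs (Module ℝ ↥(sobolevSubmodule n s p))

/-- The inclusion `W^{s,p}(ℝⁿ) ⊆ L^p(ℝⁿ)`. -/
def Sobolev.toLp {n : ℕ} {s p : ℝ} :
    Sobolev n s p →ₗ[ℝ] Lp ℝ (ex p) (volume : Measure (Rn n)) :=
  (sobolevSubmodule n s p).subtype

instance (n : ℕ) (s p : ℝ) : CoeFun (Sobolev n s p) (fun _ => Rn n → ℝ) :=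
  ⟨fun u => (u.toLp : Rn n → ℝ)⟩

theorem Sobolev.memLp_diffQuot {n : ℕ} {s p : ℝ} (u : Sobolev n s p) :
    MemLp (diffQuot n s p u) (ex p) volume := u.2

/-- The norm `‖u‖_{s,p} = (∫ |u|^p + [u]_{s,p}^p)^(1/p)`. -/
instance (n : ℕ) (s p : ℝ) : Norm (Sobolev n s p) :=
  ⟨fun u => ((∫ x, |u x| ^ p) + gagliardo n s p u) ^ (1 / p)⟩

theorem Sobolev.norm_def {n : ℕ} {s p : ℝ} (u : Sobolev n s p) :
    ‖u‖ = ((∫ x, |u x| ^ p) + gagliardo n s p u) ^ (1 / p) := rfl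

theorem gagliardo_eq {n : ℕ} {s p : ℝ} (hp : 0 < p) (u : Rn n → ℝ) :
    gagliardo n s p u = ∫ z, |diffQuot n s p u z| ^ p := by
  unfold gagliardo
  congr 1
  funext z
  have h0 : (0 : ℝ) ≤ ‖z.1 - z.2‖ := norm_nonneg _
  rw [diffQuot, abs_div, abs_of_nonneg (Real.rpow_nonneg h0 _),
    Real.div_rpow (abs_nonneg _) (Real.rpow_nonneg h0 _), ← Real.rpow_mul h0]
  congr 2
  field_simp

theorem norm_toLp_rpow {α : Type*} [MeasurableSpace α] {μ : Measure α} {p : ℝ} (hp : 0 < p)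
    (g : Lp ℝ (ex p) μ) : ‖g‖ ^ p = ∫ x, |g x| ^ p ∂μ := by
  have h1 : ex p ≠ 0 := by simpa [ex] using hp
  have h2 : ex p ≠ ∞ := ENNReal.ofReal_ne_top
  have h3 : (ex p).toReal = p := ENNReal.toReal_ofReal hp.le
  have h4 := (Lp.memLp g).eLpNorm_eq_integral_rpow_norm h1 h2
  have h5 : 0 ≤ ∫ x, ‖g x‖ ^ p ∂μ := integral_nonneg fun x => by positivity
  rw [Lp.norm_def, h4, h3, ENNReal.toReal_ofReal (by positivity), ← Real.rpow_mul h5,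
    inv_mul_cancel₀ hp.ne', Real.rpow_one]
  rfl

/-- The linear map `u ↦ (u, (u(x) - u(y)) / |x - y|^(n/p + s))` of `W^{s,p}(ℝⁿ)` into
`L^p(ℝⁿ) × L^p(ℝⁿ × ℝⁿ)`; it shows that `‖·‖_{s,p}` is a norm. -/
def Sobolev.graph {n : ℕ} {s p : ℝ} : Sobolev n s p →ₗ[ℝ]
    WithLp (ex p) (Lp ℝ (ex p) (volume : Measure (Rn n)) ×
      Lp ℝ (ex p) (volume : Measure (Rn n × Rn n))) where
  toFun u := WithLp.toLp (ex p) (u.toLp, MemLp.toLp _ u.memLp_diffQuot)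
  map_add' u v := by
    have h : MemLp.toLp _ (u + v).memLp_diffQuot
        = MemLp.toLp _ u.memLp_diffQuot + MemLp.toLp _ v.memLp_diffQuot := by
      rw [← MemLp.toLp_add]
      refine MemLp.toLp_congr _ _ ?_
      have h := diffQuot_congr (s := s) (p := p) (Lp.coeFn_add u.toLp v.toLp)
      rw [diffQuot_add] at h
      simpa only [map_add] using h
    rw [h, map_add]
    rfl
  map_smul' c u := by
    have h : MemLp.toLp _ (c • u).memLp_diffQuot = c • MemLp.toLp _ u.memLp_diffQuot := by
      rw [← MemLp.toLp_const_smul]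
      refine MemLp.toLp_congr _ _ ?_
      have h := diffQuot_congr (s := s) (p := p) (Lp.coeFn_smul c u.toLp)
      rw [diffQuot_smul] at h
      simpa only [map_smul] using h
    rw [h, map_smul]
    rfl

theorem Sobolev.norm_eq_norm_graph {n : ℕ} {s p : ℝ} [hp : Fact (1 < p)] (u : Sobolev n s p) :
    ‖u‖ = ‖u.graph‖ := by
  have hp0 : 0 < p := zero_lt_one.trans hp.out
  have h3 : (ex p).toReal = p := ENNReal.toReal_ofReal hp0.le
  rw [WithLp.prod_norm_eq_add (by rw [h3]; exact hp0), h3, norm_toLp_rpow hp0,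
    norm_toLp_rpow hp0, Sobolev.norm_def, gagliardo_eq hp0]
  congr 2
  refine integral_congr_ae ?_
  filter_upwards [MemLp.coeFn_toLp u.memLp_diffQuot] with z hz
  change _ = |(MemLp.toLp _ u.memLp_diffQuot : _ → ℝ) z| ^ p
  rw [hz]

theorem Sobolev.normCore (n : ℕ) (s p : ℝ) [hp : Fact (1 < p)] :
    NormedSpace.Core ℝ (Sobolev n s p) where
  norm_nonneg u := by rw [Sobolev.norm_eq_norm_graph]; exact norm_nonneg _
  norm_smul c u := by simp only [Sobolev.norm_eq_norm_graph, map_smul, norm_smul]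
  norm_triangle u v := by
    simp only [Sobolev.norm_eq_norm_graph, map_add]; exact norm_add_le _ _
  norm_eq_zero_iff u := by
    rw [Sobolev.norm_eq_norm_graph, norm_eq_zero]
    refine ⟨fun h => ?_, fun h => by rw [h, map_zero]⟩
    have h1 : u.toLp = 0 := congrArg WithLp.fst h
    exact Subtype.ext h1

instance (n : ℕ) (s p : ℝ) [Fact (1 < p)] : NormedAddCommGroup (Sobolev n s p) :=
  NormedAddCommGroup.ofCore (Sobolev.normCore n s p)

instance (n : ℕ) (s p : ℝ) [Fact (1 < p)] : NormedSpace ℝ (Sobolev n s p) :=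
  NormedSpace.ofCore (Sobolev.normCore n s p)

/-- The test functions `C_c^∞(Ω)`: smooth functions on `ℝⁿ` whose support is a compact
subset of `Ω`. -/
def IsTestFunction {n : ℕ} (Ω : Set (Rn n)) (φ : Rn n → ℝ) : Prop :=
  ContDiff ℝ ((⊤ : ℕ∞) : WithTop ℕ∞) φ ∧ HasCompactSupport φ ∧ tsupport φ ⊆ Ω

/-- `C_c^∞(Ω)` as a linear subspace of `W^{s,p}(ℝⁿ)`. -/
def testSubmodule (n : ℕ) (s p : ℝ) (Ω : Set (Rn n)) : Submodule ℝ (Sobolev n s p) where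
  carrier := {u | ∃ φ : Rn n → ℝ, IsTestFunction Ω φ ∧ u =ᵐ[volume] φ}
  zero_mem' := by
    refine ⟨0, ⟨contDiff_const, HasCompactSupport.zero, by simp [tsupport]⟩, ?_⟩
    rw [map_zero]
    exact Lp.coeFn_zero ℝ (ex p) volume
  add_mem' := by
    rintro u v ⟨φ, ⟨h1, h2, h3⟩, hφ⟩ ⟨ψ, ⟨k1, k2, k3⟩, hψ⟩
    refine ⟨φ + ψ, ⟨h1.add k1, h2.add k2, (tsupport_add φ ψ).trans (Set.union_subset h3 k3)⟩, ?_⟩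
    rw [map_add]
    exact (Lp.coeFn_add _ _).trans (hφ.add hψ)
  smul_mem' := by
    rintro c u ⟨φ, ⟨h1, h2, h3⟩, hφ⟩
    refine ⟨c • φ, ⟨h1.const_smul c, h2.smul_left (f := fun _ => c),
      (tsupport_smul_subset_right (fun _ => c) φ).trans h3⟩, ?_⟩
    rw [map_smul]
    exact (Lp.coeFn_smul _ _).trans (hφ.const_smul c)

/-- `W_0^{s,p}(Ω)`: the closure of `C_c^∞(Ω)` in `W^{s,p}(ℝⁿ)` with respect to `‖·‖_{s,p}`. -/
def W0 (n : ℕ) (s p : ℝ) [Fact (1 < p)] (Ω : Set (Rn n)) : Submodule ℝ (Sobolev n s p) :=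
  (testSubmodule n s p Ω).topologicalClosure

/-- The pairing `⟨(-Δ_p)^s u, v⟩`. For `u, v ∈ W^{s,p}(ℝⁿ)` the integral converges absolutely. -/
def fracPLaplacian {n : ℕ} {s p : ℝ} (u v : Sobolev n s p) : ℝ :=
  ∫ z : Rn n × Rn n, |u z.1 - u z.2| ^ (p - 2) * (u z.1 - u z.2) * (v z.1 - v z.2) /
    ‖z.1 - z.2‖ ^ ((n : ℝ) + s * p)

/-- `u` is a weak solution of `(-Δ_p)^s u = f` in `Ω`, `u = 0` in `ℝⁿ \ Ω`, where `Ω ⊆ D` and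
`f ∈ W^{-s,p'}(D) = W_0^{s,p}(D)'`: `u ∈ W_0^{s,p}(Ω)` and `⟨(-Δ_p)^s u, v⟩ = ⟨f, v⟩` for all
`v ∈ W_0^{s,p}(Ω)`. All functions are taken as elements of `W_0^{s,p}(D) ⊇ W_0^{s,p}(Ω)`. -/
def IsDirichletSolution {n : ℕ} {s p : ℝ} [Fact (1 < p)] {D : Set (Rn n)}
    (f : StrongDual ℝ (W0 n s p D)) (Ω : Set (Rn n)) (u : W0 n s p D) : Prop :=
  (u : Sobolev n s p) ∈ W0 n s p Ω ∧
    ∀ v : W0 n s p D, (v : Sobolev n s p) ∈ W0 n s p Ω →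
      fracPLaplacian (u : Sobolev n s p) (v : Sobolev n s p) = f v

/-- The relative capacity `cap_{s,p}(E; D)`: the infimum of `[u]_{s,p}^p` over the
`u ∈ W_0^{s,p}(D)` with `u ≥ 1` (a.e.) in an open neighbourhood of `E`. It is `∞` if there is
no such `u`. -/
def relCap (n : ℕ) (s p : ℝ) [Fact (1 < p)] (E D : Set (Rn n)) : ℝ≥0∞ :=
  ⨅ (u : Sobolev n s p) (_ : u ∈ W0 n s p D)
    (_ : ∃ U : Set (Rn n), IsOpen U ∧ E ⊆ U ∧ ∀ᵐ x ∂volume, x ∈ U → 1 ≤ u x),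
    ENNReal.ofReal (gagliardo n s p u)

/-- Hausdorff complementary distance of `Ω₁, Ω₂ ⊆ D`: the Hausdorff distance between the
complements of `Ω₁` and `Ω₂` in the compact set `closure D`. -/
def hausdorffComplDist {n : ℕ} (D Ω₁ Ω₂ : Set (Rn n)) : ℝ≥0∞ :=
  Metric.hausdorffEDist (closure D \ Ω₁) (closure D \ Ω₂)

/-- Weak convergence of a sequence in a normed space. -/
def WeakTendsto {V : Type*} [NormedAddCommGroup V] [NormedSpace ℝ V] (u : ℕ → V) (v : V) :
    Prop :=
  Tendsto (fun k => toWeakSpace ℝ V (u k)) atTop (𝓝 (toWeakSpace ℝ V v))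

end FracSob

end

namespace FracSob

theorem abs_midpoint_rpow_lt {p : ℝ} (hp : 1 < p) {a b : ℝ} (hab : a ≠ b) :
    |(a + b) / 2| ^ p < (|a| ^ p + |b| ^ p) / 2 := by
  have hp0 : 0 < p := by linarith
  by_cases h : |a| = |b|
  · rcases abs_eq_abs.1 h with h | h
    · exact absurd h hab
    · have hb : b ≠ 0 := by rintro rfl; simp at h; exact hab h
      have : 0 < |b| ^ p := Real.rpow_pos_of_pos (abs_pos.2 hb) p
      rw [h, neg_add_cancel, zero_div, abs_zero, Real.zero_rpow hp0.ne', abs_neg]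
      linarith
  · have h1 := (strictConvexOn_rpow hp).2 (abs_nonneg a) (abs_nonneg b) h
      (by norm_num : (0 : ℝ) < 1 / 2) (by norm_num : (0 : ℝ) < 1 / 2) (by norm_num)
    have h2 : |(a + b) / 2| ^ p ≤ ((1 / 2 : ℝ) • |a| + (1 / 2 : ℝ) • |b|) ^ p := by
      refine Real.rpow_le_rpow (abs_nonneg _) ?_ hp0.le
      rw [abs_div, abs_two, smul_eq_mul, smul_eq_mul]
      linarith [abs_add_le a b]
    simp only [smul_eq_mul] at h1 h2
    linarith

theorem abs_midpoint_rpow_le {p : ℝ} (hp : 1 < p) (a b : ℝ) :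
    |(a + b) / 2| ^ p ≤ (|a| ^ p + |b| ^ p) / 2 := by
  by_cases h : a = b
  · subst h; simp
  · exact (abs_midpoint_rpow_lt hp h).le

theorem exists_abs_sub_rpow_le_of_sphere {p : ℝ} (hp : 1 < p) {ε : ℝ} (hε : 0 < ε) :
    ∃ C : ℝ, 0 ≤ C ∧ ∀ a b : ℝ, |a| ^ p + |b| ^ p = 1 →
      |a - b| ^ p ≤ ε + C * (1 / 2 - |(a + b) / 2| ^ p) := by
  have hp0 : 0 < p := by linarith
  have hc : ∀ g : ℝ × ℝ → ℝ, Continuous g → Continuous fun z => |g z| ^ p := fun g hg =>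
    hg.abs.rpow_const fun _ => Or.inr hp0.le
  let S : Set (ℝ × ℝ) := {z | |z.1| ^ p + |z.2| ^ p = 1 ∧ ε ≤ |z.1 - z.2| ^ p}
  have hle : ∀ x : ℝ, |x| ^ p ≤ 1 → |x| ≤ 1 := fun x hx => by
    by_contra! h
    exact absurd (Real.one_lt_rpow h hp0) (not_lt.2 hx)
  have hS : IsCompact S := by
    refine Metric.isCompact_of_isClosed_isBounded ?_ ?_
    · exact (isClosed_eq ((hc _ continuous_fst).add (hc _ continuous_snd)) continuous_const).inter
        (isClosed_le continuous_const (hc _ (continuous_fst.sub continuous_snd)))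
    · refine (Metric.isBounded_closedBall (x := (0 : ℝ × ℝ)) (r := 1)).subset fun z hz => ?_
      have h1 : 0 ≤ |z.1| ^ p := by positivity
      have h2 : 0 ≤ |z.2| ^ p := by positivity
      rw [mem_closedBall_zero_iff, Prod.norm_def]
      exact max_le (hle _ (by linarith [hz.1])) (hle _ (by linarith [hz.1]))
  have hpos : ∀ z ∈ S, 0 < 1 / 2 - |(z.1 + z.2) / 2| ^ p := fun z hz => by
    have hne : z.1 ≠ z.2 := by
      intro h
      have := hz.2
      rw [h, sub_self, abs_zero, Real.zero_rpow hp0.ne'] at this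
      linarith
    have := abs_midpoint_rpow_lt hp hne
    rw [hz.1] at this
    linarith
  obtain ⟨C, hC⟩ := hS.exists_bound_of_continuousOn
    (f := fun z : ℝ × ℝ => |z.1 - z.2| ^ p / (1 / 2 - |(z.1 + z.2) / 2| ^ p))
    (((hc _ (continuous_fst.sub continuous_snd)).continuousOn).div
      (continuous_const.sub (hc _ ((continuous_fst.add continuous_snd).div_const 2))).continuousOn
      fun z hz => (hpos z hz).ne')
  refine ⟨max C 0, le_max_right _ _, fun a b hab => ?_⟩
  have h0 : 0 ≤ 1 / 2 - |(a + b) / 2| ^ p := by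
    have := abs_midpoint_rpow_le hp a b
    rw [hab] at this
    linarith
  by_cases h : ε ≤ |a - b| ^ p
  · have hz : (a, b) ∈ S := ⟨hab, h⟩
    have h1 := (le_abs_self _).trans (hC _ hz)
    have h2 := hpos _ hz
    simp only at h1 h2
    rw [div_le_iff₀ h2] at h1
    have := mul_le_mul_of_nonneg_right (le_max_left C 0) h2.le
    linarith
  · have := mul_nonneg (le_max_right C 0) h0
    linarith

/-- A quantitative form of the strict convexity of `|·| ^ p`. -/
theorem exists_abs_sub_rpow_le {p : ℝ} (hp : 1 < p) {ε : ℝ} (hε : 0 < ε) :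
    ∃ C : ℝ, 0 ≤ C ∧ ∀ a b : ℝ, |a - b| ^ p ≤
      ε * (|a| ^ p + |b| ^ p) + C * ((|a| ^ p + |b| ^ p) / 2 - |(a + b) / 2| ^ p) := by
  have hp0 : 0 < p := by linarith
  obtain ⟨C, hC0, hC⟩ := exists_abs_sub_rpow_le_of_sphere hp hε
  refine ⟨C, hC0, fun a b => ?_⟩
  set R := |a| ^ p + |b| ^ p with hR
  have ha : 0 ≤ |a| ^ p := by positivity
  have hb : 0 ≤ |b| ^ p := by positivity
  rcases (add_nonneg ha hb).eq_or_lt with h0 | h0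
  · have ha' : |a| ^ p = 0 := by linarith
    have hb' : |b| ^ p = 0 := by linarith
    rw [Real.rpow_eq_zero (abs_nonneg _) hp0.ne', abs_eq_zero] at ha' hb'
    simp [hR, ha', hb', Real.zero_rpow hp0.ne']
  · change 0 < R at h0
    set r := R ^ (1 / p) with hr
    have hrpos : 0 < r := Real.rpow_pos_of_pos h0 _
    have hrp : r ^ p = R := by
      rw [hr, ← Real.rpow_mul h0.le, one_div, inv_mul_cancel₀ hp0.ne', Real.rpow_one]
    have hs : ∀ x : ℝ, |x / r| ^ p = |x| ^ p / R := fun x => by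
      rw [abs_div, abs_of_pos hrpos, Real.div_rpow (abs_nonneg _) hrpos.le, hrp]
    have h1 := hC (a / r) (b / r) (by rw [hs, hs, ← add_div]; exact div_self h0.ne')
    have e1 : a / r - b / r = (a - b) / r := by ring
    have e2 : (a / r + b / r) / 2 = ((a + b) / 2) / r := by ring
    rw [e1, e2, hs, hs, div_le_iff₀ h0] at h1
    refine h1.trans (le_of_eq ?_)
    have h0' : R ≠ 0 := h0.ne'
    field_simp

/-- Uniform convexity of the `p`-th power of a norm. -/
def UniformlyConvexPow (V : Type*) [NormedAddCommGroup V] [NormedSpace ℝ V] (p : ℝ) : Prop :=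
  ∀ ε : ℝ, 0 < ε → ∃ C : ℝ, 0 ≤ C ∧ ∀ x y : V, ‖x - y‖ ^ p ≤
    ε * (‖x‖ ^ p + ‖y‖ ^ p) +
      C * ((‖x‖ ^ p + ‖y‖ ^ p) / 2 - ‖(1 / 2 : ℝ) • (x + y)‖ ^ p)

theorem integrable_abs_rpow {α : Type*} [MeasurableSpace α] {μ : Measure α} {p : ℝ} (hp : 0 < p)
    {g : α → ℝ} (hg : MemLp g (ex p) μ) : Integrable (fun x => |g x| ^ p) μ := by
  have h := hg.integrable_norm_rpow (by simpa [ex] using hp) ENNReal.ofReal_ne_top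
  rwa [ENNReal.toReal_ofReal hp.le] at h

theorem norm_toLp_rpow_eq {α : Type*} [MeasurableSpace α] {μ : Measure α} {p : ℝ} (hp : 0 < p)
    {g : α → ℝ} (hg : MemLp g (ex p) μ) : ‖hg.toLp g‖ ^ p = ∫ x, |g x| ^ p ∂μ := by
  rw [norm_toLp_rpow hp]
  refine integral_congr_ae ?_
  filter_upwards [hg.coeFn_toLp] with x hx
  rw [hx]

theorem exists_integral_abs_sub_rpow_le {p : ℝ} (hp : 1 < p) {ε : ℝ} (hε : 0 < ε) :
    ∃ C : ℝ, 0 ≤ C ∧ ∀ {α : Type} [MeasurableSpace α] {μ : Measure α} {g h : α → ℝ},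
      MemLp g (ex p) μ → MemLp h (ex p) μ → ∫ x, |g x - h x| ^ p ∂μ ≤
        ε * (∫ x, |g x| ^ p ∂μ + ∫ x, |h x| ^ p ∂μ) +
          C * ((∫ x, |g x| ^ p ∂μ + ∫ x, |h x| ^ p ∂μ) / 2
            - ∫ x, |(g x + h x) / 2| ^ p ∂μ) := by
  have hp0 : 0 < p := by linarith
  obtain ⟨C, hC0, hC⟩ := exists_abs_sub_rpow_le hp hε
  refine ⟨C, hC0, fun {α _ μ g h} hg hh => ?_⟩
  have i1 := integrable_abs_rpow hp0 hg
  have i2 := integrable_abs_rpow hp0 hh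
  have i3 := integrable_abs_rpow hp0 (hg.sub hh)
  have i4 : Integrable (fun x => |(g x + h x) / 2| ^ p) μ := by
    have := integrable_abs_rpow hp0 ((hg.add hh).const_smul (1 / 2 : ℝ))
    refine this.congr (Eventually.of_forall fun x => ?_)
    simp only [Pi.smul_apply, Pi.add_apply, smul_eq_mul]
    congr 2; ring
  have i5 : Integrable (fun x => |g x| ^ p + |h x| ^ p) μ := i1.add i2
  have i6 : Integrable (fun x => C * ((|g x| ^ p + |h x| ^ p) / 2 - |(g x + h x) / 2| ^ p)) μ :=
    ((i5.div_const 2).sub i4).const_mul C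
  have h1 := integral_mono (μ := μ) i3 ((i5.const_mul ε).add i6) (fun x => hC (g x) (h x))
  refine h1.trans (le_of_eq ?_)
  simp only [Pi.add_apply]
  rw [integral_add (i5.const_mul ε) i6, integral_const_mul, integral_const_mul,
    integral_sub (i5.div_const 2) i4, integral_div, integral_add i1 i2]

/-- In a complete space whose norm has a uniformly convex power, a bounded sequence which tends
to zero for a weaker continuous norm is not bounded away from zero by a functional. -/
theorem UniformlyConvexPow.exists_lt_apply {V : Type*} [NormedAddCommGroup V] [NormedSpace ℝ V]
    [CompleteSpace V] {p : ℝ} (hp : 0 < p) (hV : UniformlyConvexPow V p) {y : ℕ → V} {B : ℝ}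
    (hB : ∀ k, ‖y k‖ ≤ B) (N : Seminorm ℝ V) (hNc : Continuous N) (hN : ∀ x, N x = 0 → x = 0)
    (hy : Tendsto (fun k => N (y k)) atTop (𝓝 0)) (F : StrongDual ℝ V) {c : ℝ} (hc : c < 0) :
    ∃ k, c < F (y k) := by
  by_contra! hF
  let K : ℕ → Set V := fun m => closure (convexHull ℝ (y '' Set.Ici m))
  have hKc : ∀ m, Convex ℝ (K m) := fun m => (convex_convexHull ℝ _).closure
  have hKanti : ∀ {i j}, i ≤ j → K j ⊆ K i := fun h =>
    closure_mono (convexHull_mono (Set.image_mono (Set.Ici_subset_Ici.2 h)))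
  have hmem : ∀ m, y m ∈ K m := fun m =>
    subset_closure (subset_convexHull ℝ _ ⟨m, Set.self_mem_Ici, rfl⟩)
  have hsub : ∀ m (S : Set V), Convex ℝ S → IsClosed S → (∀ k, m ≤ k → y k ∈ S) → K m ⊆ S := by
    intro m S h1 h2 h3
    refine closure_minimal (convexHull_min ?_ h1) h2
    rintro _ ⟨k, hk, rfl⟩
    exact h3 k hk
  let d : ℕ → ℝ := fun m => sInf ((fun x => ‖x‖ ^ p) '' K m)
  have hbdd : ∀ m, BddBelow ((fun x => ‖x‖ ^ p) '' K m) := fun m =>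
    ⟨0, by rintro _ ⟨x, -, rfl⟩; positivity⟩
  have hdle : ∀ m x, x ∈ K m → d m ≤ ‖x‖ ^ p := fun m x hx =>
    csInf_le (hbdd m) ⟨x, hx, rfl⟩
  have hdmono : Monotone d := fun i j h =>
    csInf_le_csInf (hbdd i) ⟨_, _, hmem j, rfl⟩ (Set.image_mono (hKanti h))
  have hB0 : 0 ≤ B := (norm_nonneg _).trans (hB 0)
  have hdB : ∀ m, d m ≤ B ^ p := fun m =>
    (hdle m _ (hmem m)).trans (Real.rpow_le_rpow (norm_nonneg _) (hB m) hp.le)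
  have hdt : Tendsto d atTop (𝓝 (⨆ m, d m)) :=
    tendsto_atTop_ciSup hdmono ⟨B ^ p, by rintro _ ⟨m, rfl⟩; exact hdB m⟩
  set d' := ⨆ m, d m
  have hdd' : ∀ m, d m ≤ d' := fun m => hdmono.ge_of_tendsto hdt m
  have hex : ∀ m : ℕ, ∃ x ∈ K m, ‖x‖ ^ p < d m + 1 / ((m : ℝ) + 1) := fun m => by
    obtain ⟨_, ⟨x, hx, rfl⟩, h⟩ := exists_lt_of_csInf_lt (s := (fun x => ‖x‖ ^ p) '' K m)
      ⟨_, _, hmem m, rfl⟩ (show sInf _ < d m + 1 / ((m : ℝ) + 1) by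
        have : (0 : ℝ) < 1 / ((m : ℝ) + 1) := by positivity
        exact lt_add_of_pos_right _ this)
    exact ⟨x, hx, h⟩
  choose x hxK hx using hex
  have hd'0 : 0 < d' + 2 := by
    have h1 : 0 ≤ d 0 := Real.sInf_nonneg (by rintro _ ⟨x, -, rfl⟩; positivity)
    linarith [hdd' 0]
  have hcau : CauchySeq x := by
    rw [Metric.cauchySeq_iff']
    intro ε hε
    have hεp : 0 < ε ^ p := Real.rpow_pos_of_pos hε p
    obtain ⟨C, hC0, hC⟩ := hV (ε ^ p / (4 * (d' + 2))) (div_pos hεp (by linarith))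
    have hlim : Tendsto (fun m : ℕ => C * (d' + 1 / ((m : ℝ) + 1) - d m)) atTop (𝓝 0) := by
      have := ((tendsto_const_nhds (x := d')).add
        (tendsto_one_div_add_atTop_nhds_zero_nat (𝕜 := ℝ))).sub hdt
      simpa using this.const_mul C
    obtain ⟨m, hm⟩ := (hlim.eventually_lt_const (half_pos hεp)).exists
    refine ⟨m, fun i hi => ?_⟩
    have hb : ∀ j, m ≤ j → ‖x j‖ ^ p ≤ d' + 1 / ((m : ℝ) + 1) := fun j hj => by
      have : (1 : ℝ) / ((j : ℝ) + 1) ≤ 1 / ((m : ℝ) + 1) := by gcongr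
      linarith [hx j, hdd' j]
    have hmid : d m ≤ ‖(1 / 2 : ℝ) • (x i + x m)‖ ^ p := by
      refine hdle m _ ?_
      rw [smul_add]
      exact hKc m (hKanti hi (hxK i)) (hxK m) (by norm_num) (by norm_num) (by norm_num)
    have h1 := hC (x i) (x m)
    have hbi := hb i hi
    have hbm := hb m le_rfl
    have hm1 : (1 : ℝ) / ((m : ℝ) + 1) ≤ 1 := by
      rw [div_le_one (by positivity)]; linarith [(Nat.cast_nonneg m : (0 : ℝ) ≤ m)]
    have h2 : ε ^ p / (4 * (d' + 2)) * (‖x i‖ ^ p + ‖x m‖ ^ p) ≤ ε ^ p / 2 := by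
      calc _ ≤ ε ^ p / (4 * (d' + 2)) * (2 * (d' + 2)) :=
          mul_le_mul_of_nonneg_left (by linarith) (div_pos hεp (by linarith)).le
        _ = ε ^ p / 2 := by
          have : d' + 2 ≠ 0 := by linarith
          field_simp; norm_num
    have h3 : C * ((‖x i‖ ^ p + ‖x m‖ ^ p) / 2 - ‖(1 / 2 : ℝ) • (x i + x m)‖ ^ p)
        ≤ C * (d' + 1 / ((m : ℝ) + 1) - d m) := by gcongr; linarith
    rw [dist_eq_norm]
    refine lt_of_not_ge fun h => ?_
    have := Real.rpow_le_rpow hε.le h hp.le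
    linarith
  obtain ⟨z, hz⟩ := cauchySeq_tendsto_of_complete hcau
  have hzK : ∀ m, z ∈ K m := fun m =>
    isClosed_closure.mem_of_tendsto hz ((eventually_ge_atTop m).mono fun i hi => hKanti hi (hxK i))
  have hz0 : z = 0 := by
    refine hN z (le_antisymm (le_of_forall_pos_le_add fun ε hε => ?_) (apply_nonneg N z))
    obtain ⟨m, hm⟩ := eventually_atTop.1 (hy.eventually_lt_const hε)
    have := hsub m {x | N x ≤ ε}
      (by simpa using (N.convexOn.convex_le ε)) (isClosed_le hNc continuous_const)
      (fun k hk => (hm k hk).le) (hzK m)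
    simpa using this
  have := hsub 0 {x | F x ≤ c} (convex_halfSpace_le F.isLinear c)
    (isClosed_le F.continuous continuous_const) (fun k _ => hF k) (hzK 0)
  rw [hz0] at this
  simp at this
  linarith

section Basic

variable {n : ℕ} {s p : ℝ}

/-- The element of `W^{s,p}` represented by a function. -/
noncomputable def Sobolev.ofMemLp (w : Rn n → ℝ) (hw : MemLp w (ex p) volume)
    (hd : MemLp (diffQuot n s p w) (ex p) volume) : Sobolev n s p :=
  ⟨hw.toLp w, (memLp_congr_ae (diffQuot_congr hw.coeFn_toLp)).2 hd⟩

theorem Sobolev.coeFn_ofMemLp (w : Rn n → ℝ) (hw : MemLp w (ex p) volume)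
    (hd : MemLp (diffQuot n s p w) (ex p) volume) :
    (Sobolev.ofMemLp w hw hd : Rn n → ℝ) =ᵐ[volume] w :=
  hw.coeFn_toLp

theorem Sobolev.ext_ae {u v : Sobolev n s p} (h : u =ᵐ[volume] v) : u = v :=
  Subtype.ext (Lp.ext h)

theorem Sobolev.memLp (u : Sobolev n s p) : MemLp u (ex p) volume := Lp.memLp u.toLp

theorem Sobolev.coeFn_add (u v : Sobolev n s p) :
    ((u + v : Sobolev n s p) : Rn n → ℝ) =ᵐ[volume] u + v := by
  rw [map_add]; exact Lp.coeFn_add _ _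

theorem Sobolev.coeFn_sub (u v : Sobolev n s p) :
    ((u - v : Sobolev n s p) : Rn n → ℝ) =ᵐ[volume] u - v := by
  rw [map_sub]; exact Lp.coeFn_sub _ _

theorem Sobolev.coeFn_smul (c : ℝ) (u : Sobolev n s p) :
    ((c • u : Sobolev n s p) : Rn n → ℝ) =ᵐ[volume] c • u := by
  rw [map_smul]; exact Lp.coeFn_smul _ _

theorem abs_diffQuot_rpow (hp : 0 < p) (u : Rn n → ℝ) (z : Rn n × Rn n) :
    |diffQuot n s p u z| ^ p = |u z.1 - u z.2| ^ p / ‖z.1 - z.2‖ ^ ((n : ℝ) + s * p) := by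
  have h0 : (0 : ℝ) ≤ ‖z.1 - z.2‖ := norm_nonneg _
  rw [diffQuot, abs_div, abs_of_nonneg (Real.rpow_nonneg h0 _),
    Real.div_rpow (abs_nonneg _) (Real.rpow_nonneg h0 _), ← Real.rpow_mul h0]
  congr 2
  field_simp

/-- The difference quotient, as a linear map into `L^p(ℝⁿ × ℝⁿ)`. -/
noncomputable def Sobolev.dq :
    Sobolev n s p →ₗ[ℝ] Lp ℝ (ex p) (volume : Measure (Rn n × Rn n)) where
  toFun u := (Sobolev.graph u).snd
  map_add' u v := by rw [map_add]; rfl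
  map_smul' c u := by rw [map_smul]; rfl

theorem Sobolev.coeFn_dq (u : Sobolev n s p) :
    (Sobolev.dq u : Rn n × Rn n → ℝ) =ᵐ[volume] diffQuot n s p u :=
  u.memLp_diffQuot.coeFn_toLp

variable [hp : Fact (1 < p)]

theorem exponent_pos (p : ℝ) [hp : Fact (1 < p)] : 0 < p := zero_lt_one.trans hp.out

theorem Sobolev.norm_dq_rpow (u : Sobolev n s p) : ‖Sobolev.dq u‖ ^ p = gagliardo n s p u := by
  rw [gagliardo_eq (exponent_pos p)]
  exact norm_toLp_rpow_eq (exponent_pos p) u.memLp_diffQuot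

theorem Sobolev.norm_rpow (u : Sobolev n s p) :
    ‖u‖ ^ p = ‖u.toLp‖ ^ p + ‖Sobolev.dq u‖ ^ p := by
  have hp0 := exponent_pos p
  have h1 : 0 ≤ (∫ x, |u x| ^ p) + gagliardo n s p u := by
    rw [← norm_toLp_rpow hp0, ← Sobolev.norm_dq_rpow]; positivity
  rw [Sobolev.norm_def, ← Real.rpow_mul h1, one_div, inv_mul_cancel₀ hp0.ne', Real.rpow_one,
    norm_toLp_rpow hp0, Sobolev.norm_dq_rpow]

theorem Sobolev.norm_toLp_le (u : Sobolev n s p) : ‖u.toLp‖ ≤ ‖u‖ := by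
  have hp0 := exponent_pos p
  rw [← Real.rpow_le_rpow_iff (norm_nonneg _) (norm_nonneg _) hp0, Sobolev.norm_rpow]
  have : 0 ≤ ‖Sobolev.dq u‖ ^ p := by positivity
  linarith

theorem Sobolev.norm_dq_le (u : Sobolev n s p) : ‖Sobolev.dq u‖ ≤ ‖u‖ := by
  have hp0 := exponent_pos p
  rw [← Real.rpow_le_rpow_iff (norm_nonneg _) (norm_nonneg _) hp0, Sobolev.norm_rpow]
  have : 0 ≤ ‖u.toLp‖ ^ p := by positivity
  linarith

theorem Sobolev.norm_le (u : Sobolev n s p) : ‖u‖ ≤ ‖u.toLp‖ + ‖Sobolev.dq u‖ := by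
  have hp0 := exponent_pos p
  rw [← Real.rpow_le_rpow_iff (norm_nonneg _) (by positivity) hp0, Sobolev.norm_rpow]
  exact Real.add_rpow_le_rpow_add (norm_nonneg _) (norm_nonneg _) hp.out.le

theorem Sobolev.continuous_toLp : Continuous (Sobolev.toLp : Sobolev n s p → _) :=
  AddMonoidHomClass.continuous_of_bound Sobolev.toLp 1 fun u => by
    simpa using u.norm_toLp_le

theorem Sobolev.continuous_dq : Continuous (Sobolev.dq : Sobolev n s p → _) :=
  AddMonoidHomClass.continuous_of_bound Sobolev.dq 1 fun u => by
    simpa using u.norm_dq_le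

theorem exists_seq_tendsto_ae_of_tendsto_Lp {α : Type*} [MeasurableSpace α] {μ : Measure α}
    {u : ℕ → Lp ℝ (ex p) μ} {v : Lp ℝ (ex p) μ} (h : Tendsto u atTop (𝓝 v)) :
    ∃ ns : ℕ → ℕ, StrictMono ns ∧
      ∀ᵐ x ∂μ, Tendsto (fun j => u (ns j) x) atTop (𝓝 (v x)) :=
  (tendstoInMeasure_of_tendsto_Lp h).exists_seq_tendsto_ae

instance : CompleteSpace (Sobolev n s p) := by
  refine Metric.complete_of_cauchySeq_tendsto fun u hu => ?_
  have h1 : CauchySeq fun k => (u k).toLp := by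
    rw [Metric.cauchySeq_iff'] at hu ⊢
    intro ε hε
    obtain ⟨N, hN⟩ := hu ε hε
    refine ⟨N, fun k hk => lt_of_le_of_lt ?_ (hN k hk)⟩
    rw [dist_eq_norm, dist_eq_norm, ← map_sub]
    exact Sobolev.norm_toLp_le _
  have h2 : CauchySeq fun k => Sobolev.dq (u k) := by
    rw [Metric.cauchySeq_iff'] at hu ⊢
    intro ε hε
    obtain ⟨N, hN⟩ := hu ε hε
    refine ⟨N, fun k hk => lt_of_le_of_lt ?_ (hN k hk)⟩
    rw [dist_eq_norm, dist_eq_norm, ← map_sub]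
    exact Sobolev.norm_dq_le _
  obtain ⟨a, ha⟩ := cauchySeq_tendsto_of_complete h1
  obtain ⟨g, hg⟩ := cauchySeq_tendsto_of_complete h2
  obtain ⟨ns, hns, hae⟩ := exists_seq_tendsto_ae_of_tendsto_Lp ha
  obtain ⟨ms, hms, hbe⟩ := exists_seq_tendsto_ae_of_tendsto_Lp (hg.comp hns.tendsto_atTop)
  have q1 := (Measure.quasiMeasurePreserving_fst (μ := (volume : Measure (Rn n)))
      (ν := (volume : Measure (Rn n)))).ae hae
  have q2 := (Measure.quasiMeasurePreserving_snd (μ := (volume : Measure (Rn n)))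
      (ν := (volume : Measure (Rn n)))).ae hae
  have hq := ae_all_iff.2 fun j => Sobolev.coeFn_dq (u j)
  have key : diffQuot n s p a =ᵐ[volume] g := by
    filter_upwards [q1, q2, hq, hbe] with z z1 z2 z3 z4
    have t1 : Tendsto (fun j => diffQuot n s p (u (ns (ms j))) z) atTop
        (𝓝 (diffQuot n s p a z)) :=
      ((z1.comp hms.tendsto_atTop).sub (z2.comp hms.tendsto_atTop)).div_const _
    refine tendsto_nhds_unique t1 (z4.congr fun j => ?_)
    simp only [Function.comp]
    rw [z3]
  have hmem : MemLp (diffQuot n s p a) (ex p) volume := (memLp_congr_ae key).2 (Lp.memLp g)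
  refine ⟨⟨a, hmem⟩, ?_⟩
  set v : Sobolev n s p := ⟨a, hmem⟩
  have hv1 : v.toLp = a := rfl
  have hv2 : Sobolev.dq v = g := Lp.ext ((Sobolev.coeFn_dq v).trans key)
  rw [tendsto_iff_norm_sub_tendsto_zero]
  have h3 := (tendsto_iff_norm_sub_tendsto_zero.1 ha).add (tendsto_iff_norm_sub_tendsto_zero.1 hg)
  rw [add_zero] at h3
  refine squeeze_zero (fun _ => norm_nonneg _) (fun k => ?_) h3
  rw [← hv1, ← hv2, ← map_sub, ← map_sub]
  exact Sobolev.norm_le _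

theorem exists_norm_Lp_sub_rpow_le (p : ℝ) [hp : Fact (1 < p)] {ε : ℝ} (hε : 0 < ε) :
    ∃ C : ℝ, 0 ≤ C ∧ ∀ {α : Type} [MeasurableSpace α] {μ : Measure α} (g h : Lp ℝ (ex p) μ),
      ‖g - h‖ ^ p ≤ ε * (‖g‖ ^ p + ‖h‖ ^ p) +
        C * ((‖g‖ ^ p + ‖h‖ ^ p) / 2 - ‖(1 / 2 : ℝ) • (g + h)‖ ^ p) := by
  obtain ⟨C, hC0, hC⟩ := exists_integral_abs_sub_rpow_le hp.out hε
  refine ⟨C, hC0, fun {α _ μ} g h => ?_⟩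
  have h1 := hC (Lp.memLp g) (Lp.memLp h)
  simp only [norm_toLp_rpow (exponent_pos p)]
  have e1 : ∫ x, |(g - h : Lp ℝ (ex p) μ) x| ^ p ∂μ = ∫ x, |g x - h x| ^ p ∂μ := by
    refine integral_congr_ae ?_
    filter_upwards [Lp.coeFn_sub g h] with x hx
    rw [hx, Pi.sub_apply]
  have e2 : ∫ x, |((1 / 2 : ℝ) • (g + h) : Lp ℝ (ex p) μ) x| ^ p ∂μ =
      ∫ x, |(g x + h x) / 2| ^ p ∂μ := by
    refine integral_congr_ae ?_
    filter_upwards [Lp.coeFn_smul (1 / 2 : ℝ) (g + h), Lp.coeFn_add g h] with x hx hx'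
    rw [hx, Pi.smul_apply, hx', Pi.add_apply, smul_eq_mul]
    congr 2; ring
  rw [e1, e2]
  exact h1

theorem Sobolev.uniformlyConvexPow : UniformlyConvexPow (Sobolev n s p) p := by
  intro ε hε
  obtain ⟨C, hC0, hC⟩ := exists_norm_Lp_sub_rpow_le p hε
  refine ⟨C, hC0, fun u v => ?_⟩
  have h1 := hC u.toLp v.toLp
  have h2 := hC (Sobolev.dq u) (Sobolev.dq v)
  simp only [Sobolev.norm_rpow, map_sub, map_add, map_smul]
  linarith

theorem UniformlyConvexPow.submodule {V : Type*} [NormedAddCommGroup V] [NormedSpace ℝ V]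
    {q : ℝ} (h : UniformlyConvexPow V q) (S : Submodule ℝ V) : UniformlyConvexPow S q := by
  intro ε hε
  obtain ⟨C, hC0, hC⟩ := h ε hε
  exact ⟨C, hC0, fun u v => hC u v⟩

theorem isClosed_W0 (Ω : Set (Rn n)) : IsClosed (W0 n s p Ω : Set (Sobolev n s p)) :=
  Submodule.isClosed_topologicalClosure _

instance (D : Set (Rn n)) : CompleteSpace (W0 n s p D) :=
  (isClosed_W0 D).completeSpace_coe

theorem W0_mono {Ω₁ Ω₂ : Set (Rn n)} (h : Ω₁ ⊆ Ω₂) : W0 n s p Ω₁ ≤ W0 n s p Ω₂ := by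
  refine Submodule.topologicalClosure_mono ?_
  rintro u ⟨φ, ⟨h1, h2, h3⟩, h4⟩
  exact ⟨φ, ⟨h1, h2, h3.trans h⟩, h4⟩

theorem ae_eq_zero_of_mem_W0 {Ω : Set (Rn n)} {u : Sobolev n s p} (hu : u ∈ W0 n s p Ω) :
    ∀ᵐ x, x ∉ Ω → u x = 0 := by
  rw [W0, ← SetLike.mem_coe, Submodule.topologicalClosure_coe, mem_closure_iff_seq_limit] at hu
  obtain ⟨v, hv, hvu⟩ := hu
  have h1 : Tendsto (fun k => (v k).toLp) atTop (𝓝 u.toLp) :=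
    (Sobolev.continuous_toLp.tendsto u).comp hvu
  obtain ⟨ns, hns, hae⟩ := exists_seq_tendsto_ae_of_tendsto_Lp h1
  choose φ hφ using hv
  filter_upwards [hae, ae_all_iff.2 fun k => (hφ k).2] with x hx hx2 hxΩ
  refine tendsto_nhds_unique hx (tendsto_const_nhds.congr fun j => ?_)
  rw [hx2]
  exact (image_eq_zero_of_notMem_tsupport fun h => hxΩ ((hφ (ns j)).1.2.2 h)).symm

/-- The fractional Poincaré inequality in a bounded set. -/
theorem exists_norm_rpow_le_gagliardo (hn : 1 ≤ n) (hs : 0 < s) {D : Set (Rn n)}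
    (hD : Bornology.IsBounded D) :
    ∃ C : ℝ, 0 ≤ C ∧ ∀ u ∈ W0 n s p D, ‖u‖ ^ p ≤ C * gagliardo n s p u := by
  have hp0 := exponent_pos p
  obtain ⟨R, hR0, hR⟩ : ∃ R : ℝ, 0 < R ∧ ∀ x ∈ D, ‖x‖ ≤ R := by
    obtain ⟨R, h⟩ := hD.exists_norm_le
    exact ⟨max R 1, by positivity, fun x hx => (h x hx).trans (le_max_left _ _)⟩
  let A : Set (Rn n) := {y | R < ‖y‖ ∧ ‖y‖ < 3 * R}
  have hAo : IsOpen A := (isOpen_lt continuous_const continuous_norm).inter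
    (isOpen_lt continuous_norm continuous_const)
  have hAfin : volume A ≠ ∞ := by
    refine ((measure_mono (fun y hy => ?_)).trans_lt
      (measure_ball_lt_top (μ := volume) (x := (0 : Rn n)) (r := 3 * R))).ne
    simpa using hy.2
  have hApos : 0 < volume.real A := by
    refine ENNReal.toReal_pos (hAo.measure_pos volume ?_).ne' hAfin
    refine ⟨EuclideanSpace.single ⟨0, hn⟩ (2 * R), ?_⟩
    have : ‖(EuclideanSpace.single ⟨0, hn⟩ (2 * R) : Rn n)‖ = 2 * R := by
      rw [PiLp.norm_single, Real.norm_of_nonneg (by positivity)]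
    constructor <;> rw [this] <;> linarith
  set K : ℝ := (4 * R) ^ ((n : ℝ) + s * p)
  have hK : 0 ≤ K := by positivity
  refine ⟨K / volume.real A + 1, by positivity, fun u hu => ?_⟩
  have hz := ae_eq_zero_of_mem_W0 hu
  have hz1 := (Measure.quasiMeasurePreserving_fst (μ := (volume : Measure (Rn n)))
      (ν := (volume : Measure (Rn n)))).ae hz
  have hz2 := (Measure.quasiMeasurePreserving_snd (μ := (volume : Measure (Rn n)))
      (ν := (volume : Measure (Rn n)))).ae hz
  have hint : Integrable (fun z : Rn n × Rn n =>
      |u z.1 - u z.2| ^ p / ‖z.1 - z.2‖ ^ ((n : ℝ) + s * p)) volume := by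
    simpa only [abs_diffQuot_rpow hp0] using integrable_abs_rpow hp0 u.memLp_diffQuot
  have hle : ∀ᵐ z : Rn n × Rn n, |u z.1| ^ p * A.indicator (fun _ => (1 : ℝ)) z.2 ≤
      K * (|u z.1 - u z.2| ^ p / ‖z.1 - z.2‖ ^ ((n : ℝ) + s * p)) := by
    filter_upwards [hz1, hz2] with z h1 h2
    have h0 : 0 ≤ K * (|u z.1 - u z.2| ^ p / ‖z.1 - z.2‖ ^ ((n : ℝ) + s * p)) := by positivity
    by_cases hA : z.2 ∈ A
    · by_cases hx : z.1 ∈ D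
      · have hzD : z.2 ∉ D := fun h => absurd (hR _ h) (not_le.2 hA.1)
        have hxR := hR _ hx
        rw [Set.indicator_of_mem hA, mul_one, h2 hzD, sub_zero]
        have hpos : 0 < ‖z.1 - z.2‖ := by
          rw [norm_pos_iff, sub_ne_zero]
          intro h
          rw [h] at hx
          exact hzD hx
        have hd : ‖z.1 - z.2‖ ≤ 4 * R := (norm_sub_le _ _).trans (by linarith [hA.2])
        have hd' : ‖z.1 - z.2‖ ^ ((n : ℝ) + s * p) ≤ K :=
          Real.rpow_le_rpow hpos.le hd (by positivity)
        rw [mul_div_assoc', le_div_iff₀ (Real.rpow_pos_of_pos hpos _), mul_comm]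
        gcongr
      · rw [h1 hx, abs_zero, Real.zero_rpow hp0.ne', zero_mul]
        rw [h1 hx] at h0
        exact h0
    · rw [Set.indicator_of_notMem hA, mul_zero]
      exact h0
  have hmono := integral_mono_of_nonneg (μ := (volume : Measure (Rn n × Rn n)))
    (Eventually.of_forall fun z => mul_nonneg (by positivity)
      (Set.indicator_nonneg (fun _ _ => zero_le_one) _)) (hint.const_mul K) hle
  have e1 : ∫ z : Rn n × Rn n, |u z.1| ^ p * A.indicator (fun _ => (1 : ℝ)) z.2 =
      (∫ x, |u x| ^ p) * volume.real A := by
    rw [Measure.volume_eq_prod, integral_prod_mul (fun x => |u x| ^ p),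
      integral_indicator_const _ hAo.measurableSet, smul_eq_mul, mul_one]
  rw [e1, integral_const_mul] at hmono
  rw [Sobolev.norm_rpow, norm_toLp_rpow hp0, Sobolev.norm_dq_rpow, add_mul, one_mul,
    div_mul_eq_mul_div]
  gcongr
  rw [le_div_iff₀ hApos]
  exact hmono

end Basic

/-- Continuity of translations in `L^p`, for a continuous family of measure preserving maps. -/
theorem exists_eLpNorm_comp_sub_le {p : ℝ} [hp : Fact (1 < p)] {Z X : Type*}
    [NormedAddCommGroup Z] [TopologicalSpace X] [R1Space X] [MeasurableSpace X] [BorelSpace X]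
    {μ : Measure X} [IsLocallyFiniteMeasure μ] [μ.InnerRegularCompactLTTop]
    {T : Z → X → X} (hT : Continuous fun q : Z × X => T q.1 q.2) (hT0 : ∀ x, T 0 x = x)
    (hTm : ∀ z, MeasurePreserving (T z) μ μ) {g : X → ℝ} (hg : MemLp g (ex p) μ)
    {ε : ℝ} (hε : 0 < ε) :
    ∃ δ : ℝ, 0 < δ ∧ ∀ z, ‖z‖ < δ →
      eLpNorm (fun x => g (T z x) - g x) (ex p) μ ≤ ENNReal.ofReal ε := by
  let c : C(Z, C(X, X)) := (ContinuousMap.mk (fun q : Z × X => T q.1 q.2) hT).curry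
  have h1 : Tendsto (fun z => Lp.compMeasurePreserving (c z) (hTm z) (hg.toLp g)) (𝓝 0)
      (𝓝 (Lp.compMeasurePreserving (c 0) (hTm 0) (hg.toLp g))) :=
    Filter.Tendsto.compMeasurePreservingLp tendsto_const_nhds (c.continuous.tendsto 0) hTm (hTm 0)
      ENNReal.ofReal_ne_top
  obtain ⟨δ, hδ, h2⟩ := Metric.eventually_nhds_iff.1 (Metric.tendsto_nhds.1 h1 ε hε)
  refine ⟨δ, hδ, fun z hz => ?_⟩
  have h3 := (h2 (y := z) (by simpa using hz)).le
  rw [dist_eq_norm, Lp.norm_def] at h3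
  have h4 := (ENNReal.le_ofReal_iff_toReal_le (Lp.eLpNorm_ne_top _) hε.le).2 h3
  refine le_trans (le_of_eq (eLpNorm_congr_ae ?_)) h4
  have e1 := Lp.coeFn_compMeasurePreserving (hg.toLp g) (hTm z)
  have e2 := Lp.coeFn_compMeasurePreserving (hg.toLp g) (hTm 0)
  have e3 := (hTm z).quasiMeasurePreserving.ae hg.coeFn_toLp
  have e4 := (hTm 0).quasiMeasurePreserving.ae hg.coeFn_toLp
  filter_upwards [e1, e2, e3, e4, Lp.coeFn_sub
    (Lp.compMeasurePreserving (c z) (hTm z) (hg.toLp g))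
    (Lp.compMeasurePreserving (c 0) (hTm 0) (hg.toLp g))] with x e1 e2 e3 e4 e5
  rw [e5, Pi.sub_apply]
  change _ = (Lp.compMeasurePreserving (T z) (hTm z) (hg.toLp g) : X → ℝ) x -
    (Lp.compMeasurePreserving (T 0) (hTm 0) (hg.toLp g) : X → ℝ) x
  rw [e1, e2]
  simp only [Function.comp]
  rw [e3, e4, hT0]

theorem eLpNorm_ex_rpow {p : ℝ} (hp0 : 0 < p) {X : Type*} [MeasurableSpace X] (μ : Measure X)
    (h : X → ℝ) : eLpNorm h (ex p) μ ^ p = ∫⁻ x, ‖h x‖ₑ ^ p ∂μ := by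
  rw [eLpNorm_eq_lintegral_rpow_enorm_toReal (by simpa [ex] using hp0) ENNReal.ofReal_ne_top,
    ENNReal.toReal_ofReal hp0.le, ← ENNReal.rpow_mul, one_div, inv_mul_cancel₀ hp0.ne',
    ENNReal.rpow_one]

/-- Minkowski's inequality for averages over a probability measure. -/
theorem eLpNorm_integral_le {p : ℝ} [hp : Fact (1 < p)] {Z X : Type*} [MeasurableSpace Z]
    [MeasurableSpace X] {ν : Measure Z} [IsProbabilityMeasure ν] {μ : Measure X} [SFinite μ]
    {F : Z → X → ℝ} (hF : Measurable fun q : Z × X => F q.1 q.2) {c : ℝ≥0∞}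
    (hc : ∀ᵐ z ∂ν, eLpNorm (F z) (ex p) μ ≤ c) :
    eLpNorm (fun x => ∫ z, F z x ∂ν) (ex p) μ ≤ c := by
  have hp0 := exponent_pos p
  rw [← ENNReal.rpow_le_rpow_iff hp0, eLpNorm_ex_rpow hp0]
  have h1 : ∀ x, ‖∫ z, F z x ∂ν‖ₑ ^ p ≤ ∫⁻ z, ‖F z x‖ₑ ^ p ∂ν := fun x => by
    have hm : Measurable fun z => F z x := hF.comp (measurable_id.prodMk measurable_const)
    have h2 : ∫⁻ z, ‖F z x‖ₑ ∂ν ≤ eLpNorm (fun z => F z x) (ex p) ν := by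
      rw [← eLpNorm_one_eq_lintegral_enorm]
      exact eLpNorm_le_eLpNorm_of_exponent_le Fact.out hm.aestronglyMeasurable
    rw [← eLpNorm_ex_rpow hp0]
    exact ENNReal.rpow_le_rpow ((enorm_integral_le_lintegral_enorm _).trans h2) hp0.le
  calc ∫⁻ x, ‖∫ z, F z x ∂ν‖ₑ ^ p ∂μ ≤ ∫⁻ x, ∫⁻ z, ‖F z x‖ₑ ^ p ∂ν ∂μ := lintegral_mono h1
    _ = ∫⁻ z, ∫⁻ x, ‖F z x‖ₑ ^ p ∂μ ∂ν := by
      refine (lintegral_lintegral_swap (f := fun z x => ‖F z x‖ₑ ^ p) ?_).symm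
      exact (hF.enorm.pow_const p).aemeasurable
    _ ≤ ∫⁻ _, c ^ p ∂ν := by
      refine lintegral_mono_ae (hc.mono fun z hz => ?_)
      rw [← eLpNorm_ex_rpow hp0]
      exact ENNReal.rpow_le_rpow hz hp0.le
    _ = c ^ p := by simp

section Mollify

variable {n : ℕ}

/-- The probability measure whose density is a normalised bump function. -/
noncomputable def bumpMeasure (ρ : ContDiffBump (0 : Rn n)) : Measure (Rn n) :=
  (volume : Measure (Rn n)).withDensity fun z => (Real.toNNReal (ρ.normed volume z) : ℝ≥0∞)

theorem measurable_bumpDensity (ρ : ContDiffBump (0 : Rn n)) :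
    Measurable fun z => Real.toNNReal (ρ.normed volume z) :=
  (ρ.continuous_normed (μ := volume)).measurable.real_toNNReal

instance (ρ : ContDiffBump (0 : Rn n)) : IsProbabilityMeasure (bumpMeasure ρ) where
  measure_univ := by
    rw [bumpMeasure, withDensity_apply _ MeasurableSet.univ, Measure.restrict_univ]
    have := ofReal_integral_eq_lintegral_ofReal (ρ.integrable_normed (μ := volume))
      (Eventually.of_forall ρ.nonneg_normed)
    rw [ρ.integral_normed] at this
    rw [ENNReal.ofReal_one] at this
    exact this.symm

theorem ae_bumpMeasure_norm_lt (ρ : ContDiffBump (0 : Rn n)) :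
    ∀ᵐ z ∂(bumpMeasure ρ), ‖z‖ < ρ.rOut := by
  rw [bumpMeasure, ae_withDensity_iff (measurable_bumpDensity ρ).coe_nnreal_ennreal]
  refine Eventually.of_forall fun z hz => ?_
  have : z ∈ Function.support (ρ.normed volume) := by
    intro h
    simp [h] at hz
  rw [ρ.support_normed_eq] at this
  simpa using this

theorem integral_bumpMeasure (ρ : ContDiffBump (0 : Rn n)) (h : Rn n → ℝ) :
    ∫ z, h z ∂(bumpMeasure ρ) = ∫ z, ρ.normed volume z * h z := by
  rw [bumpMeasure, integral_withDensity_eq_integral_smul (measurable_bumpDensity ρ)]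
  refine integral_congr_ae (Eventually.of_forall fun z => ?_)
  simp only [NNReal.smul_def, smul_eq_mul, Real.coe_toNNReal _ (ρ.nonneg_normed z)]

theorem integrable_bumpMeasure (ρ : ContDiffBump (0 : Rn n)) {h : Rn n → ℝ}
    (hh : Integrable fun z => ρ.normed volume z * h z) : Integrable h (bumpMeasure ρ) := by
  rw [bumpMeasure, integrable_withDensity_iff_integrable_smul (measurable_bumpDensity ρ)]
  refine hh.congr (Eventually.of_forall fun z => ?_)
  simp only [NNReal.smul_def, smul_eq_mul, Real.coe_toNNReal _ (ρ.nonneg_normed z)]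

theorem measurePreserving_sub_diag (z : Rn n) : MeasurePreserving
    (fun q : Rn n × Rn n => (q.1 - z, q.2 - z)) volume volume :=
  (measurePreserving_sub_right volume z).prod (measurePreserving_sub_right volume z)

variable {s p : ℝ}

theorem measurable_diffQuot {w : Rn n → ℝ} (hw : Measurable w) :
    Measurable (diffQuot n s p w) := by
  have h1 : Measurable fun z : Rn n × Rn n => ‖z.1 - z.2‖ :=
    (continuous_fst.sub continuous_snd).norm.measurable
  exact ((hw.comp measurable_fst).sub (hw.comp measurable_snd)).div (h1.pow_const _)

variable [hp : Fact (1 < p)]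

/-- Mollification of a function with compact support. -/
theorem exists_testFunction_eLpNorm_sub_le {Ω K : Set (Rn n)} (hΩ : IsOpen Ω) (hK : IsCompact K)
    (hKΩ : K ⊆ Ω) {w : Rn n → ℝ} (hwm : Measurable w) (hwK : ∀ x, x ∉ K → w x = 0)
    (hwL : MemLp w (ex p) volume) (hwq : MemLp (diffQuot n s p w) (ex p) volume)
    {ε : ℝ} (hε : 0 < ε) :
    ∃ φ, IsTestFunction Ω φ ∧ eLpNorm (φ - w) (ex p) volume ≤ ENNReal.ofReal ε ∧
      eLpNorm (diffQuot n s p φ - diffQuot n s p w) (ex p) volume ≤ ENNReal.ofReal ε := by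
  have hwqm := measurable_diffQuot (s := s) (p := p) hwm
  have hwloc : LocallyIntegrable w volume := hwL.locallyIntegrable Fact.out
  obtain ⟨δ₁, hδ₁, h₁⟩ := exists_eLpNorm_comp_sub_le (μ := (volume : Measure (Rn n)))
    (T := fun z x : Rn n => x - z) (by fun_prop) (by simp)
    (fun z => measurePreserving_sub_right volume z) hwL hε
  obtain ⟨δ₂, hδ₂, h₂⟩ := exists_eLpNorm_comp_sub_le (μ := (volume : Measure (Rn n × Rn n)))
    (T := fun (z : Rn n) (q : Rn n × Rn n) => (q.1 - z, q.2 - z)) (by fun_prop) (by simp)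
    measurePreserving_sub_diag hwq hε
  obtain ⟨δ₃, hδ₃, h₃⟩ := hK.exists_cthickening_subset_open hΩ hKΩ
  set δ := min δ₁ (min δ₂ δ₃)
  have hδ : 0 < δ := lt_min hδ₁ (lt_min hδ₂ hδ₃)
  let ρ : ContDiffBump (0 : Rn n) := ⟨δ / 2, δ, by positivity, by linarith⟩
  have hρ : ρ.rOut = δ := rfl
  let φ : Rn n → ℝ := fun x => ∫ z, w (x - z) ∂(bumpMeasure ρ)
  have hφc : φ = convolution (ρ.normed volume) w (ContinuousLinearMap.lsmul ℝ ℝ) volume := by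
    funext x
    simp only [φ, integral_bumpMeasure, convolution_def, ContinuousLinearMap.lsmul_apply,
      smul_eq_mul]
  have hint : ∀ x, Integrable (fun z => w (x - z)) (bumpMeasure ρ) := fun x =>
    integrable_bumpMeasure ρ ((ρ.hasCompactSupport_normed (μ := volume)).convolutionExists_left
      (ContinuousLinearMap.lsmul ℝ ℝ) ρ.continuous_normed hwloc x)
  have hsmooth : ContDiff ℝ ((⊤ : ℕ∞) : WithTop ℕ∞) φ := by
    rw [hφc]
    exact (ρ.hasCompactSupport_normed (μ := volume)).contDiff_convolution_left _
      ρ.contDiff_normed hwloc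
  have hsupp : Function.support φ ⊆ Metric.cthickening δ K := by
    rw [hφc]
    refine (support_convolution_subset _).trans ?_
    rintro x ⟨a, ha, b, hb, rfl⟩
    rw [ρ.support_normed_eq, hρ, mem_ball_zero_iff] at ha
    have hbK : b ∈ K := by
      by_contra h
      exact hb (hwK b h)
    refine Metric.mem_cthickening_of_dist_le _ b _ _ hbK ?_
    simpa [dist_eq_norm] using ha.le
  have hKδ : IsCompact (Metric.cthickening δ K) := hK.cthickening
  have htest : IsTestFunction Ω φ := by
    refine ⟨hsmooth, HasCompactSupport.of_support_subset_isCompact hKδ hsupp, ?_⟩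
    refine (closure_minimal hsupp hKδ.isClosed).trans (Set.Subset.trans ?_ h₃)
    exact Metric.cthickening_mono ((min_le_right _ _).trans (min_le_right _ _)) K
  refine ⟨φ, htest, ?_, ?_⟩
  · have e : φ - w = fun x => ∫ z, (w (x - z) - w x) ∂(bumpMeasure ρ) := by
      funext x
      rw [integral_sub (hint x) (integrable_const _)]
      simp [φ]
    rw [e]
    refine eLpNorm_integral_le (F := fun z x => w (x - z) - w x)
      ((hwm.comp (measurable_snd.sub measurable_fst)).sub (hwm.comp measurable_snd)) ?_
    filter_upwards [ae_bumpMeasure_norm_lt ρ] with z hz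
    exact h₁ z (hz.trans_le (min_le_left _ _))
  · have e : diffQuot n s p φ - diffQuot n s p w = fun q => ∫ z,
        (diffQuot n s p w (q.1 - z, q.2 - z) - diffQuot n s p w q) ∂(bumpMeasure ρ) := by
      funext q
      have e1 : ∀ z, diffQuot n s p w (q.1 - z, q.2 - z) =
          (w (q.1 - z) - w (q.2 - z)) / ‖q.1 - q.2‖ ^ ((n : ℝ) / p + s) := fun z => by
        simp only [diffQuot, sub_sub_sub_cancel_right]
      have hi : Integrable (fun z => w (q.1 - z) - w (q.2 - z)) (bumpMeasure ρ) :=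
        (hint q.1).sub (hint q.2)
      simp only [e1]
      rw [integral_sub (hi.div_const _) (integrable_const _), integral_div,
        integral_sub (hint q.1) (hint q.2), integral_const, probReal_univ, one_smul]
      rfl
    have hT : Measurable fun r : Rn n × (Rn n × Rn n) => (r.2.1 - r.1, r.2.2 - r.1) :=
      Continuous.measurable (by fun_prop)
    rw [e]
    refine eLpNorm_integral_le
      (F := fun z q => diffQuot n s p w (q.1 - z, q.2 - z) - diffQuot n s p w q)
      ((hwqm.comp hT).sub (hwqm.comp measurable_snd)) ?_
    filter_upwards [ae_bumpMeasure_norm_lt ρ] with z hz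
    exact h₂ z (hz.trans_le ((min_le_right _ _).trans (min_le_left _ _)))

/-- A function in `W^{s,p}` which vanishes outside a compact subset of an open set `Ω` is in
`W_0^{s,p}(Ω)`. -/
theorem mem_W0_of_ae_eq_zero {Ω K : Set (Rn n)} (hΩ : IsOpen Ω) (hK : IsCompact K) (hKΩ : K ⊆ Ω)
    {u : Sobolev n s p} (hu : ∀ᵐ x, x ∉ K → u x = 0) : u ∈ W0 n s p Ω := by
  set w : Rn n → ℝ := K.indicator u with hw_def
  have hwm : Measurable w :=
    (Lp.stronglyMeasurable u.toLp).measurable.indicator hK.isClosed.measurableSet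
  have hwu : u =ᵐ[volume] w := by
    filter_upwards [hu] with x hx
    by_cases h : x ∈ K
    · rw [hw_def, Set.indicator_of_mem h]
    · rw [hw_def, Set.indicator_of_notMem h, hx h]
  have hwL : MemLp w (ex p) volume := (memLp_congr_ae hwu).1 u.memLp
  have hwq : MemLp (diffQuot n s p w) (ex p) volume :=
    (memLp_congr_ae (diffQuot_congr hwu)).1 u.memLp_diffQuot
  rw [W0, ← SetLike.mem_coe, Submodule.topologicalClosure_coe, Metric.mem_closure_iff]
  intro ε hε
  obtain ⟨φ, htest, b₁, b₂⟩ := exists_testFunction_eLpNorm_sub_le hΩ hK hKΩ hwm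
    (fun x hx => Set.indicator_of_notMem hx _) hwL hwq (ε := ε / 3) (by positivity)
  have hφm : Measurable φ := htest.1.continuous.measurable
  have m₁ : MemLp (φ - w) (ex p) volume :=
    ⟨(hφm.sub hwm).aestronglyMeasurable, b₁.trans_lt ENNReal.ofReal_lt_top⟩
  have m₂ : MemLp (diffQuot n s p φ - diffQuot n s p w) (ex p) volume :=
    ⟨((measurable_diffQuot hφm).sub (measurable_diffQuot hwm)).aestronglyMeasurable,
      b₂.trans_lt ENNReal.ofReal_lt_top⟩
  have k₁ : MemLp φ (ex p) volume := by simpa using m₁.add hwL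
  have k₂ : MemLp (diffQuot n s p φ) (ex p) volume := by simpa using m₂.add hwq
  refine ⟨Sobolev.ofMemLp φ k₁ k₂, ⟨φ, htest, Sobolev.coeFn_ofMemLp φ k₁ k₂⟩, ?_⟩
  set v := Sobolev.ofMemLp φ k₁ k₂
  have hvφ : v =ᵐ[volume] φ := Sobolev.coeFn_ofMemLp φ k₁ k₂
  have n₁ : ‖(v - u).toLp‖ ≤ ε / 3 := by
    rw [Lp.norm_def, map_sub]
    refine ENNReal.toReal_le_of_le_ofReal (by positivity) (le_trans (le_of_eq ?_) b₁)
    exact eLpNorm_congr_ae ((Lp.coeFn_sub _ _).trans (hvφ.sub hwu))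
  have n₂ : ‖Sobolev.dq (v - u)‖ ≤ ε / 3 := by
    rw [Lp.norm_def, map_sub]
    refine ENNReal.toReal_le_of_le_ofReal (by positivity) (le_trans (le_of_eq ?_) b₂)
    exact eLpNorm_congr_ae ((Lp.coeFn_sub _ _).trans
      (((Sobolev.coeFn_dq v).trans (diffQuot_congr hvφ)).sub
        ((Sobolev.coeFn_dq u).trans (diffQuot_congr hwu))))
  rw [dist_comm, dist_eq_norm]
  linarith [Sobolev.norm_le (v - u)]

end Mollify

section SoftThreshold

/-- Truncation of `a` at height `M`, followed by soft thresholding at level `b`. -/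
noncomputable def softTrunc (M a b : ℝ) : ℝ := max (min a M - b) 0 + min (max a (-M) + b) 0

theorem softTrunc_zero {M b : ℝ} (hM : 0 ≤ M) (hb : 0 ≤ b) : softTrunc M 0 b = 0 := by
  unfold softTrunc
  rw [min_eq_left hM, max_eq_left (by linarith : -M ≤ 0), max_eq_right (by linarith),
    min_eq_right (by linarith), add_zero]

theorem softTrunc_of_le {M a b : ℝ} (hb : M ≤ b) : softTrunc M a b = 0 := by
  unfold softTrunc
  rw [max_eq_right (by linarith [min_le_right a M]),
    min_eq_right (by linarith [le_max_right a (-M)]), add_zero]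

theorem abs_softTrunc_le {M a b : ℝ} (hb : 0 ≤ b) : |softTrunc M a b| ≤ |a| := by
  unfold softTrunc
  rcases le_total 0 a with h | h
  · rw [min_eq_right (by linarith [le_max_left a (-M)] : (0 : ℝ) ≤ max a (-M) + b), add_zero,
      abs_of_nonneg (le_max_right _ _), abs_of_nonneg h]
    exact max_le (by linarith [min_le_left a M]) h
  · rw [max_eq_right (by linarith [min_le_left a M] : min a M - b ≤ 0), zero_add,
      abs_of_nonpos (min_le_right _ _), abs_of_nonpos h, neg_le_neg_iff]
    exact le_min (by linarith [le_max_left a (-M)]) h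

theorem abs_softTrunc_sub_le (M a b a' b' : ℝ) :
    |softTrunc M a b - softTrunc M a' b'| ≤ 2 * (|a - a'| + |b - b'|) := by
  have h1 : |max (min a M - b) 0 - max (min a' M - b') 0| ≤ |a - a'| + |b - b'| := by
    refine (abs_max_sub_max_le_abs _ _ _).trans ?_
    have e : min a M - b - (min a' M - b') = (min a M - min a' M) - (b - b') := by ring
    rw [e]
    refine (abs_sub _ _).trans ?_
    have h := abs_min_sub_min_le_max a M a' M
    rw [sub_self, abs_zero, max_eq_left (abs_nonneg (a - a'))] at h
    linarith
  have h2 : |min (max a (-M) + b) 0 - min (max a' (-M) + b') 0| ≤ |a - a'| + |b - b'| := by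
    have h := abs_min_sub_min_le_max (max a (-M) + b) 0 (max a' (-M) + b') 0
    rw [sub_self, abs_zero,
      max_eq_left (abs_nonneg (max a (-M) + b - (max a' (-M) + b')))] at h
    refine h.trans ?_
    have e : max a (-M) + b - (max a' (-M) + b') = (max a (-M) - max a' (-M)) + (b - b') := by ring
    rw [e]
    refine (abs_add_le _ _).trans ?_
    linarith [abs_max_sub_max_le_abs a a' (-M)]
  have e : softTrunc M a b - softTrunc M a' b' =
      (max (min a M - b) 0 - max (min a' M - b') 0) +
        (min (max a (-M) + b) 0 - min (max a' (-M) + b') 0) := by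
    unfold softTrunc; ring
  rw [e]
  linarith [abs_add_le (max (min a M - b) 0 - max (min a' M - b') 0)
    (min (max a (-M) + b) 0 - min (max a' (-M) + b') 0)]

theorem abs_softTrunc_zero_sub_le {p M : ℝ} (hp : 1 < p) (hM : 0 < M) (a : ℝ) :
    |softTrunc M a 0 - a| ≤ |a| ^ p * M ^ (1 - p) := by
  have h0 : 0 ≤ |a| ^ p * M ^ (1 - p) := by positivity
  by_cases h : |a| ≤ M
  · obtain ⟨h1, h2⟩ := abs_le.1 h
    have : softTrunc M a 0 = a := by
      unfold softTrunc
      rw [min_eq_left h2, max_eq_left h1, sub_zero, add_zero, max_add_min, add_zero]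
    rwa [this, sub_self, abs_zero]
  · push Not at h
    have h1 : |a| = |a| ^ p * |a| ^ (1 - p) := by
      rw [← Real.rpow_add (hM.trans h), add_sub_cancel, Real.rpow_one]
    have h2 : |a| ^ (1 - p) ≤ M ^ (1 - p) :=
      Real.rpow_le_rpow_of_nonpos hM h.le (by linarith)
    have h3 : |softTrunc M a 0 - a| ≤ |a| := by
      unfold softTrunc
      rw [sub_zero, add_zero]
      rcases le_total 0 a with h' | h'
      · rw [abs_of_nonneg h'] at h ⊢
        rw [min_eq_right h.le, max_eq_left hM.le, min_eq_right (le_max_of_le_left h'), abs_le]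
        constructor <;> linarith
      · rw [abs_of_nonpos h'] at h ⊢
        rw [max_eq_right (by linarith : a ≤ -M), max_eq_right (min_le_of_left_le h'),
          min_eq_left (by linarith : -M ≤ 0), abs_le]
        constructor <;> linarith
    refine h3.trans (h1.le.trans ?_)
    gcongr

theorem abs_softTrunc_sub_self_le {p M : ℝ} (hp : 1 < p) (hM : 0 < M) (a : ℝ) {b : ℝ}
    (hb : 0 ≤ b) : |softTrunc M a b - a| ≤ 2 * b + |a| ^ p * M ^ (1 - p) := by
  have h1 := abs_softTrunc_sub_le M a b a 0
  rw [sub_self, abs_zero, zero_add, sub_zero, abs_of_nonneg hb] at h1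
  have h2 := abs_softTrunc_zero_sub_le hp hM a
  have e : softTrunc M a b - a = (softTrunc M a b - softTrunc M a 0) + (softTrunc M a 0 - a) := by
    ring
  rw [e]
  exact (abs_add_le _ _).trans (add_le_add h1 h2)

theorem continuous_softTrunc (M : ℝ) : Continuous fun q : ℝ × ℝ => softTrunc M q.1 q.2 := by
  unfold softTrunc
  fun_prop

end SoftThreshold

section Weak

variable {V : Type*} [NormedAddCommGroup V] [NormedSpace ℝ V]

theorem WeakTendsto.apply {u : ℕ → V} {v : V} (h : WeakTendsto u v) (F : StrongDual ℝ V) :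
    Tendsto (fun k => F (u k)) atTop (𝓝 (F v)) :=
  ((WeakBilin.eval_continuous (topDualPairing ℝ V).flip F).tendsto _).comp h

theorem WeakTendsto.exists_norm_le {u : ℕ → V} {v : V} (h : WeakTendsto u v) :
    ∃ B, ∀ k, ‖u k‖ ≤ B := by
  obtain ⟨B, hB⟩ := banach_steinhaus
    (g := fun k => NormedSpace.inclusionInDoubleDualLi ℝ (u k)) (fun F => by
      obtain ⟨C, hC⟩ := (h.apply F).norm.bddAbove_range
      exact ⟨C, fun k => hC ⟨k, rfl⟩⟩)
  exact ⟨B, fun k => ((NormedSpace.inclusionInDoubleDualLi ℝ).norm_map (u k)).ge.trans (hB k)⟩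

/-- A closed convex set is weakly sequentially closed. -/
theorem WeakTendsto.mem_of_convex {u : ℕ → V} {v : V} (h : WeakTendsto u v) {S : Set V}
    (hS : Convex ℝ S) (hSc : IsClosed S) (hu : ∀ᶠ k in atTop, u k ∈ S) : v ∈ S := by
  by_contra hv
  obtain ⟨F, c, h1, h2⟩ := geometric_hahn_banach_closed_point hS hSc hv
  obtain ⟨k, hk, hk'⟩ := (hu.and ((h.apply F).eventually_const_lt h2)).exists
  exact absurd (h1 _ hk) (not_lt.2 hk'.le)

/-- If `u k` converges weakly to `v` and `w k` is in a closed subspace `S`, if `w k - u k` is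
bounded and tends to zero for some weaker continuous norm, then `v ∈ S`. -/
theorem WeakTendsto.mem_of_tendsto_seminorm [CompleteSpace V] {p : ℝ} (hp : 0 < p)
    (hV : UniformlyConvexPow V p) {u : ℕ → V} {v : V} (h : WeakTendsto u v) (S : Submodule ℝ V)
    (hS : IsClosed (S : Set V)) {w : ℕ → V} (hw : ∀ k, w k ∈ S) {B : ℝ}
    (hB : ∀ k, ‖w k - u k‖ ≤ B) (N : Seminorm ℝ V) (hNc : Continuous N)
    (hN : ∀ x, N x = 0 → x = 0) (hwu : Tendsto (fun k => N (w k - u k)) atTop (𝓝 0)) :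
    v ∈ S := by
  by_contra hv
  obtain ⟨F, c, h1, h2⟩ := geometric_hahn_banach_closed_point S.convex hS hv
  have h3 : (F v + c) / 2 < F v := by linarith
  obtain ⟨m, hm⟩ := eventually_atTop.1 ((h.apply F).eventually_const_lt h3)
  obtain ⟨k, hk⟩ := hV.exists_lt_apply hp (fun k => hB (k + m)) N hNc hN
    (hwu.comp (tendsto_add_atTop_nat m)) F (show (c - F v) / 2 < 0 by linarith)
  have h4 := h1 _ (hw (k + m))
  have h5 := hm (k + m) (by omega)
  rw [map_sub] at hk
  linarith

end Weak

section Limit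

variable {n : ℕ} {s p : ℝ} [hp : Fact (1 < p)]

/-- Cutting a test function off near `Ω' \ Ω`, by soft thresholding with a capacitary function. -/
theorem exists_mem_W0_of_testFunction {Ω Ω' U : Set (Rn n)} (hΩ : IsOpen Ω) (hU : IsOpen U)
    (hΩU : Ω' \ Ω ⊆ U) {ψ φ : Sobolev n s p} (hψ : ψ ∈ testSubmodule n s p Ω')
    (hφ : ∀ᵐ x, x ∈ U → 1 ≤ φ x) {M : ℝ} (hM : 0 < M) :
    ∃ w ∈ W0 n s p Ω, ‖w‖ ≤ 3 * ‖ψ‖ + 2 * (M * ‖φ‖) ∧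
      ∀ᵐ x, |w x - ψ x| ≤ 2 * (M * |φ x|) + |ψ x| ^ p * M ^ (1 - p) := by
  obtain ⟨g, ⟨-, hgc, hgΩ⟩, hψg⟩ := hψ
  let b : Rn n → ℝ := fun x => M * max (φ x) 0
  let w : Rn n → ℝ := fun x => softTrunc M (ψ x) (b x)
  have hb0 : ∀ x, 0 ≤ b x := fun x => mul_nonneg hM.le (le_max_right _ _)
  have hbφ : ∀ x, b x ≤ M * |φ x| := fun x =>
    mul_le_mul_of_nonneg_left (max_le (le_abs_self _) (abs_nonneg _)) hM.le
  have hbb : ∀ x y, |b x - b y| ≤ M * |φ x - φ y| := fun x y => by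
    rw [← mul_sub, abs_mul, abs_of_pos hM]
    exact mul_le_mul_of_nonneg_left (abs_max_sub_max_le_abs _ _ _) hM.le
  have hwm : Measurable w := by
    have h1 : Measurable ψ := (Lp.stronglyMeasurable ψ.toLp).measurable
    have h2 : Measurable φ := (Lp.stronglyMeasurable φ.toLp).measurable
    exact (continuous_softTrunc M).measurable.comp
      (h1.prodMk ((h2.max measurable_const).const_mul M))
  have hwψ : ∀ x, ‖w x‖ ≤ ‖ψ x‖ := fun x => abs_softTrunc_le (hb0 x)
  have hwL : MemLp w (ex p) volume :=
    ψ.memLp.of_le hwm.aestronglyMeasurable (Eventually.of_forall hwψ)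
  set G : Lp ℝ (ex p) (volume : Measure (Rn n × Rn n)) :=
    (2 : ℝ) • (|Sobolev.dq ψ| + M • |Sobolev.dq φ|) with hG
  have hdw : ∀ᵐ z, ‖diffQuot n s p w z‖ ≤ ‖G z‖ := by
    filter_upwards [Sobolev.coeFn_dq ψ, Sobolev.coeFn_dq φ, Lp.coeFn_abs (Sobolev.dq ψ),
      Lp.coeFn_abs (Sobolev.dq φ), Lp.coeFn_smul M |Sobolev.dq φ|,
      Lp.coeFn_add |Sobolev.dq ψ| (M • |Sobolev.dq φ|),
      Lp.coeFn_smul (2 : ℝ) (|Sobolev.dq ψ| + M • |Sobolev.dq φ|)] with z z1 z2 z3 z4 z5 z6 z7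
    rw [hG, z7, Pi.smul_apply, z6, Pi.add_apply, z5, Pi.smul_apply, z3, z4, z1, z2]
    refine le_trans ?_ (le_abs_self _)
    simp only [smul_eq_mul, Real.norm_eq_abs, diffQuot, abs_div]
    rw [← mul_div_assoc, ← add_div, ← mul_div_assoc]
    gcongr
    exact (abs_softTrunc_sub_le M _ _ _ _).trans (by linarith [hbb z.1 z.2])
  have hwq : MemLp (diffQuot n s p w) (ex p) volume :=
    (Lp.memLp G).of_le (measurable_diffQuot hwm).aestronglyMeasurable hdw
  set v := Sobolev.ofMemLp w hwL hwq with hv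
  have hvw : v =ᵐ[volume] w := Sobolev.coeFn_ofMemLp w hwL hwq
  refine ⟨v, ?_, ?_, ?_⟩
  · have hK : IsCompact (tsupport g \ U) := hgc.isCompact.diff hU
    refine mem_W0_of_ae_eq_zero hΩ hK (fun x hx => ?_) ?_
    · by_contra h
      exact hx.2 (hΩU ⟨hgΩ hx.1, h⟩)
    · filter_upwards [hvw, hψg, hφ] with x x1 x2 x3 hx
      rw [x1]
      by_cases hxU : x ∈ U
      · refine softTrunc_of_le ?_
        have h1 : 1 ≤ max (φ x) 0 := (x3 hxU).trans (le_max_left _ _)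
        exact le_mul_of_one_le_right hM.le h1
      · have h1 : ψ x = 0 := by
          rw [x2]
          exact image_eq_zero_of_notMem_tsupport fun h => hx ⟨h, hxU⟩
        change softTrunc M (ψ x) (b x) = 0
        rw [h1]
        exact softTrunc_zero hM.le (hb0 x)
  · have n1 : ‖v.toLp‖ ≤ ‖ψ.toLp‖ := by
      refine Lp.norm_le_norm_of_ae_le (hvw.mono fun x hx => ?_)
      rw [hx]; exact hwψ x
    have n2 : ‖Sobolev.dq v‖ ≤ ‖G‖ := by
      refine Lp.norm_le_norm_of_ae_le ?_
      filter_upwards [Sobolev.coeFn_dq v, diffQuot_congr (s := s) (p := p) hvw, hdw] with z z1 z2 z3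
      rw [z1, z2]; exact z3
    have n3 : ‖G‖ ≤ 2 * (‖Sobolev.dq ψ‖ + M * ‖Sobolev.dq φ‖) := by
      rw [hG, norm_smul, Real.norm_of_nonneg zero_le_two]
      gcongr
      refine (norm_add_le _ _).trans ?_
      rw [norm_smul, norm_abs_eq_norm, norm_abs_eq_norm, Real.norm_of_nonneg hM.le]
    have n4 : M * ‖Sobolev.dq φ‖ ≤ M * ‖φ‖ := mul_le_mul_of_nonneg_left φ.norm_dq_le hM.le
    linarith [Sobolev.norm_le v, ψ.norm_toLp_le, ψ.norm_dq_le]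
  · filter_upwards [hvw] with x hx
    rw [hx]
    refine (abs_softTrunc_sub_self_le hp.out hM (ψ x) (hb0 x)).trans ?_
    linarith [hbφ x]

theorem Sobolev.integrableOn (u : Sobolev n s p) {D : Set (Rn n)} (hD : volume D ≠ ∞) :
    IntegrableOn u D := by
  have : IsFiniteMeasure ((volume : Measure (Rn n)).restrict D) :=
    ⟨by rwa [Measure.restrict_apply_univ, lt_top_iff_ne_top]⟩
  exact (u.memLp.restrict D).integrable Fact.out

/-- The seminorm `∫_D |u|` on `W^{s,p}`. -/
noncomputable def l1Seminorm (n : ℕ) (s p : ℝ) [hp : Fact (1 < p)] (D : Set (Rn n))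
    (hD : volume D ≠ ∞) : Seminorm ℝ (Sobolev n s p) :=
  Seminorm.of (fun u => ∫ x in D, |u x|)
    (fun u v => by
      rw [← integral_add (u.integrableOn hD).abs (v.integrableOn hD).abs]
      refine integral_mono_ae ((u + v).integrableOn hD).abs
        ((u.integrableOn hD).abs.add (v.integrableOn hD).abs)
        (ae_restrict_of_ae ((Sobolev.coeFn_add u v).mono fun x hx => ?_))
      simp only [hx, Pi.add_apply]
      exact abs_add_le _ _)
    (fun c u => by
      rw [← integral_const_mul]
      refine integral_congr_ae (ae_restrict_of_ae ((Sobolev.coeFn_smul c u).mono fun x hx => ?_))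
      simp only [hx, Pi.smul_apply, smul_eq_mul, abs_mul, Real.norm_eq_abs])

theorem l1Seminorm_apply {D : Set (Rn n)} (hD : volume D ≠ ∞) (u : Sobolev n s p) :
    l1Seminorm n s p D hD u = ∫ x in D, |u x| := rfl

theorem exists_l1Seminorm_le {D : Set (Rn n)} (hD : volume D ≠ ∞) :
    ∃ C : ℝ, 0 ≤ C ∧ ∀ u : Sobolev n s p, l1Seminorm n s p D hD u ≤ C * ‖u‖ := by
  have hp0 := exponent_pos p
  have hC : (volume D) ^ (1 / (1 : ℝ≥0∞).toReal - 1 / (ex p).toReal) ≠ ∞ := by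
    refine ENNReal.rpow_ne_top_of_nonneg ?_ hD
    rw [ENNReal.toReal_ofReal hp0.le, ENNReal.toReal_one, one_div_one, sub_nonneg,
      div_le_one hp0]
    exact hp.out.le
  refine ⟨_, ENNReal.toReal_nonneg (a := (volume D) ^ (1 / (1 : ℝ≥0∞).toReal -
    1 / (ex p).toReal)), fun u => ?_⟩
  have hm := u.memLp.1.restrict (s := D)
  have h1 := eLpNorm_le_eLpNorm_mul_rpow_measure_univ (p := 1) (q := ex p) Fact.out hm
  rw [Measure.restrict_apply_univ, eLpNorm_one_eq_lintegral_enorm] at h1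
  have h2 : eLpNorm u (ex p) (volume.restrict D) ≤ eLpNorm u (ex p) volume :=
    eLpNorm_mono_measure _ Measure.restrict_le_self
  have h3 := h1.trans (mul_le_mul_left h2 _)
  have h4 := ENNReal.toReal_mono (ENNReal.mul_ne_top u.memLp.2.ne hC) h3
  rw [ENNReal.toReal_mul, ← integral_norm_eq_lintegral_enorm hm, ← Lp.norm_def, mul_comm] at h4
  rw [l1Seminorm_apply]
  exact h4.trans (mul_le_mul_of_nonneg_left u.norm_toLp_le ENNReal.toReal_nonneg)

theorem continuous_l1Seminorm {D : Set (Rn n)} (hD : volume D ≠ ∞) :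
    Continuous (l1Seminorm n s p D hD) := by
  obtain ⟨C, -, hC⟩ := exists_l1Seminorm_le (s := s) (p := p) hD
  refine (LipschitzWith.of_dist_le' (K := C) fun u v => ?_).continuous
  rw [Real.dist_eq, dist_eq_norm]
  exact (abs_sub_map_le_sub _ u v).trans (hC _)

theorem eq_zero_of_l1Seminorm_eq_zero {D : Set (Rn n)} (hDo : IsOpen D) (hD : volume D ≠ ∞)
    {u : Sobolev n s p} (hu : u ∈ W0 n s p D) (h : l1Seminorm n s p D hD u = 0) : u = 0 := by
  rw [l1Seminorm_apply, integral_eq_zero_iff_of_nonneg (fun _ => abs_nonneg _)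
    (u.integrableOn hD).abs, Filter.EventuallyEq, ae_restrict_iff' hDo.measurableSet] at h
  refine Sobolev.ext_ae ?_
  rw [map_zero]
  refine EventuallyEq.trans ?_ (Lp.coeFn_zero ℝ (ex p) volume).symm
  filter_upwards [h, ae_eq_zero_of_mem_W0 hu] with x h1 h2
  by_cases hx : x ∈ D
  · simpa using h1 hx
  · exact h2 hx

/-- If `u k ∈ W_0^{s,p}(Ω k)` converges weakly in `W_0^{s,p}(D)` and there are functions which are
at least `1` near `Ω k \ Ω` and tend to zero, then the weak limit is in `W_0^{s,p}(Ω)`. -/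
theorem mem_W0_of_weakTendsto_of_tendsto {D Ω : Set (Rn n)} (hDo : IsOpen D)
    (hD : volume D ≠ ∞) (hΩ : IsOpen Ω) (hΩD : Ω ⊆ D) {Ωk : ℕ → Set (Rn n)}
    {u : ℕ → W0 n s p D} (hu : ∀ k, (u k : Sobolev n s p) ∈ W0 n s p (Ωk k))
    {v : W0 n s p D} (hv : WeakTendsto u v) {φ : ℕ → Sobolev n s p} {U : ℕ → Set (Rn n)}
    (hU : ∀ k, IsOpen (U k)) (hΩU : ∀ k, Ωk k \ Ω ⊆ U k) (hφU : ∀ k, ∀ᵐ x, x ∈ U k → 1 ≤ φ k x)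
    (hφ : Tendsto (fun k => ‖φ k‖) atTop (𝓝 0)) : (v : Sobolev n s p) ∈ W0 n s p Ω := by
  have hp0 := exponent_pos p
  obtain ⟨B, hB⟩ := hv.exists_norm_le
  obtain ⟨C, hC0, hC⟩ := exists_l1Seminorm_le (s := s) (p := p) hD
  have hone : Tendsto (fun k : ℕ => 1 / ((k : ℝ) + 1)) atTop (𝓝 0) :=
    tendsto_one_div_add_atTop_nhds_zero_nat
  have hone0 : ∀ k : ℕ, 0 < 1 / ((k : ℝ) + 1) := fun k => by positivity
  let τ : ℕ → ℝ := fun k => ‖φ k‖ + 1 / ((k : ℝ) + 1)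
  have hτ0 : ∀ k, 0 < τ k := fun k => add_pos_of_nonneg_of_pos (norm_nonneg _) (hone0 k)
  have hτ : Tendsto τ atTop (𝓝 0) := by
    have h := hφ.add hone
    rwa [add_zero] at h
  have hτr : ∀ {r : ℝ}, 0 < r → Tendsto (fun k => τ k ^ r) atTop (𝓝 0) := fun {r} hr => by
    simpa [Real.zero_rpow hr.ne'] using hτ.rpow_const (p := r) (Or.inr hr.le)
  let M : ℕ → ℝ := fun k => τ k ^ (-(1 / 2) : ℝ)
  have hM0 : ∀ k, 0 < M k := fun k => Real.rpow_pos_of_pos (hτ0 k) _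
  have hMφ : ∀ k, M k * ‖φ k‖ ≤ τ k ^ (1 / 2 : ℝ) := fun k => by
    calc M k * ‖φ k‖ ≤ M k * τ k :=
          mul_le_mul_of_nonneg_left (le_add_of_nonneg_right (hone0 k).le) (hM0 k).le
      _ = τ k ^ (-(1 / 2) : ℝ) * τ k ^ (1 : ℝ) := by rw [Real.rpow_one]
      _ = τ k ^ (1 / 2 : ℝ) := by rw [← Real.rpow_add (hτ0 k)]; norm_num
  have hMp : ∀ k, M k ^ (1 - p) = τ k ^ ((p - 1) / 2) := fun k => by
    rw [← Real.rpow_mul (hτ0 k).le]; congr 1; ring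
  have hψ : ∀ k, ∃ ψ ∈ testSubmodule n s p (Ωk k), ‖ψ - u k‖ ≤ 1 / ((k : ℝ) + 1) := fun k => by
    have h := hu k
    rw [W0, ← SetLike.mem_coe, Submodule.topologicalClosure_coe, Metric.mem_closure_iff] at h
    obtain ⟨ψ, h1, h2⟩ := h _ (hone0 k)
    rw [dist_comm, dist_eq_norm] at h2
    exact ⟨ψ, h1, h2.le⟩
  choose ψ hψΩ hψu using hψ
  have hone1 : ∀ k : ℕ, 1 / ((k : ℝ) + 1) ≤ 1 := fun k => by
    rw [div_le_one (by positivity)]; linarith [(Nat.cast_nonneg k : (0 : ℝ) ≤ k)]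
  have hψB : ∀ k, ‖ψ k‖ ≤ B + 1 := fun k => by
    have h1 : ‖ψ k‖ ≤ ‖ψ k - u k‖ + ‖(u k : Sobolev n s p)‖ := by
      simpa using norm_add_le (ψ k - u k) (u k : Sobolev n s p)
    have h2 : ‖(u k : Sobolev n s p)‖ ≤ B := hB k
    linarith [hψu k, hone1 k]
  choose w hwΩ hwn hw using fun k =>
    exists_mem_W0_of_testFunction hΩ (hU k) (hΩU k) (hψΩ k) (hφU k) (hM0 k)
  obtain ⟨T, hT⟩ := (hτr (by norm_num : (0 : ℝ) < 1 / 2)).bddAbove_range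
  let N := (l1Seminorm n s p D hD)
  have hNw : ∀ k, N (w k - u k) ≤
      2 * (C * τ k ^ (1 / 2 : ℝ)) + (B + 1) ^ p * τ k ^ ((p - 1) / 2) +
        C * (1 / ((k : ℝ) + 1)) := fun k => by
    have h1 : N (w k - u k) ≤ N (w k - ψ k) + N (ψ k - u k) := by
      simpa using map_add_le_add N (w k - ψ k) (ψ k - u k)
    have h2 : N (ψ k - u k) ≤ C * (1 / ((k : ℝ) + 1)) :=
      (hC _).trans (mul_le_mul_of_nonneg_left (hψu k) hC0)
    have hi : Integrable (fun x => |ψ k x| ^ p) volume := integrable_abs_rpow hp0 (ψ k).memLp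
    have h3 : N (w k - ψ k) ≤
        ∫ x in D, (2 * (M k * |φ k x|) + |ψ k x| ^ p * M k ^ (1 - p)) := by
      refine integral_mono_ae ((w k - ψ k).integrableOn hD).abs
        ((((φ k).integrableOn hD).abs.const_mul _).const_mul _ |>.add
          (hi.integrableOn.mul_const _)) (ae_restrict_of_ae ?_)
      filter_upwards [hw k, Sobolev.coeFn_sub (w k) (ψ k)] with x x1 x2
      rw [x2]; exact x1
    rw [integral_add ((((φ k).integrableOn hD).abs.const_mul _).const_mul _)
      (hi.integrableOn.mul_const _), integral_const_mul, integral_const_mul,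
      integral_mul_const, hMp] at h3
    have h4 : M k * ∫ x in D, |φ k x| ≤ C * τ k ^ (1 / 2 : ℝ) := by
      calc M k * ∫ x in D, |φ k x| ≤ M k * (C * ‖φ k‖) :=
            mul_le_mul_of_nonneg_left (hC (φ k)) (hM0 k).le
        _ = C * (M k * ‖φ k‖) := by ring
        _ ≤ _ := mul_le_mul_of_nonneg_left (hMφ k) hC0
    have h5 : ∫ x in D, |ψ k x| ^ p ≤ (B + 1) ^ p := by
      refine (setIntegral_le_integral hi (Eventually.of_forall fun x => by positivity)).trans ?_
      rw [← norm_toLp_rpow hp0]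
      exact Real.rpow_le_rpow (norm_nonneg _) ((ψ k).norm_toLp_le.trans (hψB k)) hp0.le
    have h6 := mul_le_mul_of_nonneg_right h5 (Real.rpow_nonneg (hτ0 k).le ((p - 1) / 2))
    linarith
  refine hv.mem_of_tendsto_seminorm hp0 (Sobolev.uniformlyConvexPow.submodule _)
    ((W0 n s p Ω).comap (W0 n s p D).subtype) ((isClosed_W0 Ω).preimage continuous_subtype_val)
    (w := fun k => ⟨w k, W0_mono hΩD (hwΩ k)⟩) (B := 3 * (B + 1) + 2 * T + B) hwΩ (fun k => ?_)
    (N.comp (W0 n s p D).subtype) ((continuous_l1Seminorm hD).comp continuous_subtype_val)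
    (fun x hx => Subtype.ext (eq_zero_of_l1Seminorm_eq_zero hDo hD x.2 hx)) ?_
  · have h1 : ‖w k - u k‖ ≤ ‖w k‖ + ‖(u k : Sobolev n s p)‖ := norm_sub_le _ _
    have h2 : ‖(u k : Sobolev n s p)‖ ≤ B := hB k
    have h3 := hT ⟨k, rfl⟩
    simp only at h3
    change ‖w k - u k‖ ≤ _
    linarith [hwn k, hψB k, hMφ k]
  · have hlim := (((hτr (by norm_num : (0 : ℝ) < 1 / 2)).const_mul C).const_mul 2).add
      ((hτr (by linarith [hp.out] : 0 < (p - 1) / 2)).const_mul ((B + 1) ^ p)) |>.add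
      (hone.const_mul C)
    simp only [mul_zero, add_zero] at hlim
    exact squeeze_zero (fun k => apply_nonneg N _) hNw hlim

/-- If `u k ∈ W_0^{s,p}(Ω k)` converges weakly in `W_0^{s,p}(D)` and the relative capacity of
`Ω k \ Ω` tends to zero, then the weak limit is in `W_0^{s,p}(Ω)`. -/
theorem mem_W0_of_weakTendsto (hn : 1 ≤ n) (hs : 0 < s) {D Ω : Set (Rn n)} (hDo : IsOpen D)
    (hDb : Bornology.IsBounded D) (hΩ : IsOpen Ω) (hΩD : Ω ⊆ D) {Ωk : ℕ → Set (Rn n)}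
    {u : ℕ → W0 n s p D} (hu : ∀ k, (u k : Sobolev n s p) ∈ W0 n s p (Ωk k))
    {v : W0 n s p D} (hv : WeakTendsto u v)
    (hcap : Tendsto (fun k => relCap n s p (Ωk k \ Ω) D) atTop (𝓝 0)) :
    (v : Sobolev n s p) ∈ W0 n s p Ω := by
  have hp0 := exponent_pos p
  obtain ⟨C, hC0, hC⟩ := exists_norm_rpow_le_gagliardo (p := p) hn hs hDb
  obtain ⟨K, hK⟩ := eventually_atTop.1 (hcap.eventually_lt_const ENNReal.zero_lt_top)
  let g : ℕ → ℝ≥0∞ := fun k => relCap n s p (Ωk k \ Ω) D + ENNReal.ofReal (1 / ((k : ℝ) + 1))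
  have hg : Tendsto g atTop (𝓝 0) := by
    have := (ENNReal.continuous_ofReal.tendsto 0).comp
      (tendsto_one_div_add_atTop_nhds_zero_nat (𝕜 := ℝ))
    rw [ENNReal.ofReal_zero] at this
    have h := hcap.add this
    rwa [add_zero] at h
  have hgfin : ∀ k, K ≤ k → g k ≠ ∞ := fun k hk =>
    ENNReal.add_ne_top.2 ⟨(hK k hk).ne, ENNReal.ofReal_ne_top⟩
  have hex : ∀ k, ∃ φ ∈ W0 n s p D, ∃ U : Set (Rn n), IsOpen U ∧ Ωk (k + K) \ Ω ⊆ U ∧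
      (∀ᵐ x ∂volume, x ∈ U → 1 ≤ φ x) ∧
      ENNReal.ofReal (gagliardo n s p φ) < g (k + K) := fun k => by
    have h1 : relCap n s p (Ωk (k + K) \ Ω) D < g (k + K) :=
      ENNReal.lt_add_right (hK _ (by omega)).ne
        (ENNReal.ofReal_pos.2 (by positivity)).ne'
    rw [relCap] at h1
    simp only [iInf_lt_iff] at h1
    obtain ⟨φ, h1, ⟨U, h2, h3, h4⟩, h5⟩ := h1
    exact ⟨φ, h1, U, h2, h3, h4, h5⟩
  choose φ hφD U hU hΩU hφU hφ using hex
  refine mem_W0_of_weakTendsto_of_tendsto hDo hDb.measure_lt_top.ne hΩ hΩD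
    (u := fun k => u (k + K)) (fun k => hu (k + K)) (hv.comp (tendsto_add_atTop_nat K)) hU hΩU
    hφU ?_
  have hb : ∀ k, ‖φ k‖ ≤ (C * (g (k + K)).toReal) ^ (1 / p) := fun k => by
    have h1 : gagliardo n s p (φ k) ≤ (g (k + K)).toReal :=
      (ENNReal.ofReal_le_iff_le_toReal (hgfin _ (by omega))).1 (hφ k).le
    have h2 := (hC _ (hφD k)).trans (mul_le_mul_of_nonneg_left h1 hC0)
    have h3 := Real.rpow_le_rpow (by positivity) h2 (by positivity : 0 ≤ 1 / p)
    rwa [← Real.rpow_mul (norm_nonneg _), mul_one_div_cancel hp0.ne', Real.rpow_one] at h3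
  have hlim : Tendsto (fun k => (C * (g (k + K)).toReal) ^ (1 / p)) atTop (𝓝 0) := by
    have h1 := ((ENNReal.tendsto_toReal ENNReal.zero_ne_top).comp hg).comp
      (tendsto_add_atTop_nat K)
    have h2 := (h1.const_mul C).rpow_const (p := 1 / p) (Or.inr (by positivity))
    simpa [Real.zero_rpow (inv_ne_zero hp0.ne')] using h2
  exact squeeze_zero (fun _ => norm_nonneg _) hb hlim

end Limit

section Duality

theorem abs_rpow_sub_two_mul_self {p : ℝ} (hp : 1 < p) (a : ℝ) :
    |(|a| ^ (p - 2) * a)| = |a| ^ (p - 1) := by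
  rcases eq_or_ne a 0 with rfl | ha
  · rw [mul_zero, abs_zero, Real.zero_rpow (by linarith)]
  · have h : 0 < |a| := abs_pos.2 ha
    rw [abs_mul, abs_of_nonneg (Real.rpow_nonneg h.le _)]
    nth_rw 2 [← Real.rpow_one |a|]
    rw [← Real.rpow_add h]
    congr 1; ring

theorem abs_rpow_sub_two_mul_self_mul_self {p : ℝ} (hp : 1 < p) (a : ℝ) :
    |a| ^ (p - 2) * a * a = |a| ^ p := by
  rcases eq_or_ne a 0 with rfl | ha
  · rw [mul_zero, abs_zero, Real.zero_rpow (by linarith)]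
  · have h : 0 < |a| := abs_pos.2 ha
    rw [mul_assoc, ← abs_mul_abs_self a, ← pow_two, ← Real.rpow_natCast, ← Real.rpow_add h]
    congr 1; push_cast; ring

theorem rpow_sub_one_mul_le {p a b : ℝ} (hp : 1 < p) (ha : 0 ≤ a) (hb : 0 ≤ b) :
    p * (a ^ (p - 1) * b) ≤ (p - 1) * a ^ p + b ^ p := by
  have hp0 : 0 < p := by linarith
  have hp1 : p - 1 ≠ 0 := by linarith
  have hq := Real.HolderConjugate.conjExponent hp
  have h := Real.young_inequality_of_nonneg hb (Real.rpow_nonneg ha (p - 1)) hq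
  rw [← Real.rpow_mul ha, Real.conjExponent, mul_div_cancel₀ _ hp1] at h
  have e : (p - 1) * a ^ p + b ^ p = p * (b ^ p / p + a ^ p / (p / (p - 1))) := by
    field_simp; ring
  rw [e, mul_comm (a ^ (p - 1))]
  exact mul_le_mul_of_nonneg_left h hp0.le

theorem abs_rpow_add_mul_le {p : ℝ} (hp : 1 < p) (a b : ℝ) :
    |a| ^ p + p * (|a| ^ (p - 2) * a * (b - a)) ≤ |b| ^ p := by
  have h1 := rpow_sub_one_mul_le hp (abs_nonneg a) (abs_nonneg b)
  have h2 : |a| ^ (p - 2) * a * b ≤ |a| ^ (p - 1) * |b| := by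
    rw [← abs_rpow_sub_two_mul_self hp a, ← abs_mul]
    exact le_abs_self _
  rw [mul_sub, abs_rpow_sub_two_mul_self_mul_self hp]
  have h3 := mul_le_mul_of_nonneg_left h2 (by linarith : 0 ≤ p)
  linarith

theorem abs_rpow_mul_le {p : ℝ} (hp : 1 < p) (a b : ℝ) :
    |(|a| ^ (p - 2) * a * b)| ≤ |a| ^ p + |b| ^ p := by
  have h1 := rpow_sub_one_mul_le hp (abs_nonneg a) (abs_nonneg b)
  rw [abs_mul, abs_rpow_sub_two_mul_self hp]
  have ha : 0 ≤ |a| ^ p := by positivity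
  have hb : 0 ≤ |b| ^ p := by positivity
  have : p * (|a| ^ (p - 1) * |b|) ≤ p * (|a| ^ p + |b| ^ p) := by nlinarith
  exact le_of_mul_le_mul_left this (by linarith)

theorem continuous_abs_rpow_mul_self {p : ℝ} (hp : 1 < p) :
    Continuous fun a : ℝ => |a| ^ (p - 2) * a := by
  have h1 : Continuous (deriv fun x : ℝ => ‖x‖ ^ p) :=
    (contDiff_norm_rpow (E := ℝ) hp).continuous_deriv le_rfl
  have h2 : (deriv fun x : ℝ => ‖x‖ ^ p) = fun x => p * |x| ^ (p - 2) * x :=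
    funext fun x => (hasDerivAt_abs_rpow x hp).deriv
  rw [h2] at h1
  have hp0 : p ≠ 0 := by linarith
  refine (h1.const_mul p⁻¹).congr fun x => ?_
  field_simp

variable {α : Type*} [MeasurableSpace α] {μ : Measure α} {p : ℝ}

/-- The pairing `∫ |U|^(p-2) U V` on `L^p`. -/
noncomputable def dualityPairing (U V : Lp ℝ (ex p) μ) : ℝ :=
  ∫ z, |U z| ^ (p - 2) * U z * V z ∂μ

theorem dualityPairing_smul (U V : Lp ℝ (ex p) μ) (t : ℝ) :
    dualityPairing U (t • V) = t * dualityPairing U V := by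
  rw [dualityPairing, dualityPairing, ← integral_const_mul]
  refine integral_congr_ae ((Lp.coeFn_smul t V).mono fun z hz => ?_)
  simp only [hz, Pi.smul_apply, smul_eq_mul]
  ring

variable [hp : Fact (1 < p)]

theorem integrable_abs_rpow_mul {U V : α → ℝ} (hU : MemLp U (ex p) μ) (hV : MemLp V (ex p) μ) :
    Integrable (fun z => |U z| ^ (p - 2) * U z * V z) μ := by
  have hp0 := exponent_pos p
  refine ((integrable_abs_rpow hp0 hU).add (integrable_abs_rpow hp0 hV)).mono' ?_
    (Eventually.of_forall fun z => abs_rpow_mul_le hp.out _ _)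
  exact ((continuous_abs_rpow_mul_self hp.out).comp_aestronglyMeasurable hU.1).mul hV.1

theorem norm_rpow_add_dualityPairing_le (U V : Lp ℝ (ex p) μ) :
    ‖U‖ ^ p + p * dualityPairing U (V - U) ≤ ‖V‖ ^ p := by
  have hp0 := exponent_pos p
  have hi := integrable_abs_rpow_mul (Lp.memLp U) (Lp.memLp (V - U))
  rw [norm_toLp_rpow hp0, norm_toLp_rpow hp0, dualityPairing, ← integral_const_mul,
    ← integral_add (integrable_abs_rpow hp0 (Lp.memLp U)) (hi.const_mul p)]
  refine integral_mono_ae ((integrable_abs_rpow hp0 (Lp.memLp U)).add (hi.const_mul p))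
    (integrable_abs_rpow hp0 (Lp.memLp V)) ((Lp.coeFn_sub V U).mono fun z hz => ?_)
  simp only [hz, Pi.sub_apply]
  exact abs_rpow_add_mul_le hp.out _ _

theorem tendsto_dualityPairing (U V : Lp ℝ (ex p) μ) :
    Tendsto (fun t : ℝ => dualityPairing (U + t • V) V) (𝓝[>] 0) (𝓝 (dualityPairing U V)) := by
  have hp0 := exponent_pos p
  have e : ∀ t : ℝ, dualityPairing (U + t • V) V =
      ∫ z, |U z + t * V z| ^ (p - 2) * (U z + t * V z) * V z ∂μ := fun t => by
    refine integral_congr_ae ?_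
    filter_upwards [Lp.coeFn_add U (t • V), Lp.coeFn_smul t V] with z h1 h2
    simp only [h1, Pi.add_apply, h2, Pi.smul_apply, smul_eq_mul]
  have e0 : dualityPairing U V =
      ∫ z, |U z + 0 * V z| ^ (p - 2) * (U z + 0 * V z) * V z ∂μ := by
    simp only [zero_mul, add_zero]; rfl
  simp only [e]
  rw [e0]
  have hsum : MemLp (fun z => |U z| + |V z|) (ex p) μ := (Lp.memLp U).abs.add (Lp.memLp V).abs
  refine tendsto_integral_filter_of_dominated_convergence
    (fun z => |(|U z| + |V z|)| ^ p + |V z| ^ p) ?_ ?_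
    ((integrable_abs_rpow hp0 hsum).add (integrable_abs_rpow hp0 (Lp.memLp V))) ?_
  · refine Eventually.of_forall fun t => ?_
    exact (integrable_abs_rpow_mul ((Lp.memLp U).add ((Lp.memLp V).const_mul t)) (Lp.memLp V)).1
  · filter_upwards [Ioo_mem_nhdsGT (zero_lt_one (α := ℝ))] with t ht
    refine Eventually.of_forall fun z => (abs_rpow_mul_le hp.out _ _).trans ?_
    refine add_le_add_left (Real.rpow_le_rpow (abs_nonneg _) ?_ hp0.le) _
    rw [abs_of_nonneg (by positivity : 0 ≤ |U z| + |V z|)]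
    refine (abs_add_le _ _).trans (add_le_add_right ?_ _)
    rw [abs_mul, abs_of_pos ht.1]
    exact mul_le_of_le_one_left (abs_nonneg _) ht.2.le
  · refine Eventually.of_forall fun z => ?_
    have hc : Continuous fun t : ℝ => |U z + t * V z| ^ (p - 2) * (U z + t * V z) * V z :=
      ((continuous_abs_rpow_mul_self hp.out).comp (by fun_prop)).mul continuous_const
    exact (hc.tendsto 0).mono_left nhdsWithin_le_nhds

end Duality

section Energy

variable {n : ℕ} {s p : ℝ} [hp : Fact (1 < p)]

theorem fracPLaplacian_eq (u v : Sobolev n s p) :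
    fracPLaplacian u v = dualityPairing (Sobolev.dq u) (Sobolev.dq v) := by
  have hp0 := exponent_pos p
  refine integral_congr_ae ?_
  filter_upwards [Sobolev.coeFn_dq u, Sobolev.coeFn_dq v] with z h1 h2
  rw [h1, h2]
  simp only [diffQuot]
  rcases eq_or_ne z.1 z.2 with h | h
  · simp [h]
  · have hr : 0 < ‖z.1 - z.2‖ := norm_pos_iff.2 (sub_ne_zero.2 h)
    set r := ‖z.1 - z.2‖
    set β := (n : ℝ) / p + s with hβ
    have hβ' : (n : ℝ) + s * p = β * (p - 2) + β + β := by rw [hβ]; field_simp; ring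
    rw [abs_div, abs_of_pos (Real.rpow_pos_of_pos hr β), Real.div_rpow (abs_nonneg _)
      (Real.rpow_nonneg hr.le _), ← Real.rpow_mul hr.le, hβ', Real.rpow_add hr, Real.rpow_add hr]
    ring

/-- The energy whose minimisers are the Dirichlet solutions. -/
noncomputable def energy {D : Set (Rn n)} (f : StrongDual ℝ (W0 n s p D)) (u : W0 n s p D) : ℝ :=
  ‖Sobolev.dq (u : Sobolev n s p)‖ ^ p - p * f u

theorem continuous_energy {D : Set (Rn n)} (f : StrongDual ℝ (W0 n s p D)) :
    Continuous (energy f) :=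
  ((Sobolev.continuous_dq.comp continuous_subtype_val).norm.rpow_const
    fun _ => Or.inr (exponent_pos p).le).sub (f.continuous.const_mul p)

theorem convexOn_energy {D : Set (Rn n)} (f : StrongDual ℝ (W0 n s p D)) :
    ConvexOn ℝ Set.univ (energy f) := by
  refine ⟨convex_univ, fun u _ v _ a b ha hb hab => ?_⟩
  have h1 : ‖Sobolev.dq ((a • u + b • v : W0 n s p D) : Sobolev n s p)‖ ^ p ≤
      (a • ‖Sobolev.dq (u : Sobolev n s p)‖ + b • ‖Sobolev.dq (v : Sobolev n s p)‖) ^ p := by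
    refine Real.rpow_le_rpow (norm_nonneg _) ?_ (exponent_pos p).le
    rw [Submodule.coe_add, Submodule.coe_smul, Submodule.coe_smul, map_add, map_smul, map_smul]
    refine (norm_add_le _ _).trans (le_of_eq ?_)
    rw [norm_smul, norm_smul, Real.norm_of_nonneg ha, Real.norm_of_nonneg hb]
    rfl
  have h2 := (convexOn_rpow hp.out.le).2 (norm_nonneg (Sobolev.dq (u : Sobolev n s p)))
    (norm_nonneg (Sobolev.dq (v : Sobolev n s p))) ha hb hab
  simp only [energy, map_add, map_smul, smul_eq_mul] at *
  linarith

theorem IsDirichletSolution.energy_le {D Ω : Set (Rn n)} {f : StrongDual ℝ (W0 n s p D)}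
    {u : W0 n s p D} (hu : IsDirichletSolution f Ω u) {w : W0 n s p D}
    (hw : (w : Sobolev n s p) ∈ W0 n s p Ω) : energy f u ≤ energy f w := by
  have h1 := hu.2 (w - u) (Submodule.sub_mem _ hw hu.1)
  have h2 := norm_rpow_add_dualityPairing_le (Sobolev.dq (u : Sobolev n s p))
    (Sobolev.dq (w : Sobolev n s p))
  rw [← map_sub, ← fracPLaplacian_eq, ← Submodule.coe_sub, h1, map_sub] at h2
  unfold energy
  linarith

/-- The Euler-Lagrange equation of the energy. -/
theorem isDirichletSolution_of_energy_le {D Ω : Set (Rn n)} {f : StrongDual ℝ (W0 n s p D)}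
    {u : W0 n s p D} (hu : (u : Sobolev n s p) ∈ W0 n s p Ω)
    (h : ∀ w : W0 n s p D, (w : Sobolev n s p) ∈ W0 n s p Ω → energy f u ≤ energy f w) :
    IsDirichletSolution f Ω u := by
  have hp0 := exponent_pos p
  have key : ∀ v : W0 n s p D, (v : Sobolev n s p) ∈ W0 n s p Ω →
      f v ≤ fracPLaplacian (u : Sobolev n s p) (v : Sobolev n s p) := by
    intro v hv
    rw [fracPLaplacian_eq]
    refine ge_of_tendsto (tendsto_dualityPairing _ _) ?_
    filter_upwards [self_mem_nhdsWithin] with t ht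
    have ht0 : 0 < t := ht
    have h1 := h (u + t • v) (Submodule.add_mem _ hu (Submodule.smul_mem _ t hv))
    have h2 := norm_rpow_add_dualityPairing_le
      (Sobolev.dq (u : Sobolev n s p) + t • Sobolev.dq (v : Sobolev n s p))
      (Sobolev.dq (u : Sobolev n s p))
    have e1 : Sobolev.dq (u : Sobolev n s p) -
        (Sobolev.dq (u : Sobolev n s p) + t • Sobolev.dq (v : Sobolev n s p)) =
        (-t) • Sobolev.dq (v : Sobolev n s p) := by
      rw [sub_add_cancel_left, neg_smul]
    rw [e1, dualityPairing_smul] at h2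
    simp only [energy, Submodule.coe_add, Submodule.coe_smul, map_add, map_smul,
      smul_eq_mul] at h1
    have h3 : (p * t) * f v ≤ (p * t) * dualityPairing
      (Sobolev.dq (u : Sobolev n s p) + t • Sobolev.dq (v : Sobolev n s p))
      (Sobolev.dq (v : Sobolev n s p)) := by linarith
    exact le_of_mul_le_mul_left h3 (by positivity)
  refine ⟨hu, fun v hv => le_antisymm ?_ (key v hv)⟩
  have h1 := key ((-1 : ℝ) • v) (Submodule.smul_mem _ _ hv)
  rw [fracPLaplacian_eq, Submodule.coe_smul, map_smul, map_smul, dualityPairing_smul,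
    smul_eq_mul] at h1
  rw [fracPLaplacian_eq]
  linarith

theorem IsDirichletSolution.unique (hn : 1 ≤ n) (hs : 0 < s) {D Ω : Set (Rn n)}
    (hD : Bornology.IsBounded D) {f : StrongDual ℝ (W0 n s p D)} {u v : W0 n s p D}
    (hu : IsDirichletSolution f Ω u) (hv : IsDirichletSolution f Ω v) : u = v := by
  have hp0 := exponent_pos p
  obtain ⟨C, -, hC⟩ := exists_norm_rpow_le_gagliardo (p := p) hn hs hD
  set U := Sobolev.dq (u : Sobolev n s p) with hU
  set V := Sobolev.dq (v : Sobolev n s p) with hV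
  have hm : (((1 / 2 : ℝ) • (u + v) : W0 n s p D) : Sobolev n s p) ∈ W0 n s p Ω :=
    Submodule.smul_mem _ _ (Submodule.add_mem _ hu.1 hv.1)
  have h1 := hu.energy_le hm
  have h2 := hv.energy_le hm
  have h3 : (‖U‖ ^ p + ‖V‖ ^ p) / 2 - ‖(1 / 2 : ℝ) • (U + V)‖ ^ p ≤ 0 := by
    simp only [energy, Submodule.coe_add, Submodule.coe_smul, map_add, map_smul,
      smul_eq_mul, ← hU, ← hV] at h1 h2
    rw [smul_add] at *
    linarith
  have h4 : ‖U - V‖ ^ p ≤ 0 := by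
    refine le_of_forall_pos_le_add fun ε hε => ?_
    obtain ⟨A, hA0, hA⟩ := exists_norm_Lp_sub_rpow_le p
      (ε := ε / (‖U‖ ^ p + ‖V‖ ^ p + 1)) (by positivity)
    have h5 := hA U V
    have h6 : A * ((‖U‖ ^ p + ‖V‖ ^ p) / 2 - ‖(1 / 2 : ℝ) • (U + V)‖ ^ p) ≤ 0 :=
      mul_nonpos_of_nonneg_of_nonpos hA0 h3
    have h7 : ε / (‖U‖ ^ p + ‖V‖ ^ p + 1) * (‖U‖ ^ p + ‖V‖ ^ p) ≤ ε := by
      have hq : 0 ≤ ‖U‖ ^ p + ‖V‖ ^ p := by positivity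
      rw [div_mul_eq_mul_div, div_le_iff₀ (by positivity)]
      nlinarith
    linarith
  have h5 := hC _ (u - v).2
  rw [← Sobolev.norm_dq_rpow, Submodule.coe_sub, map_sub, le_antisymm h4 (by positivity), mul_zero]
    at h5
  have h6 := (Real.rpow_eq_zero (norm_nonneg _) hp0.ne').1 (le_antisymm h5 (by positivity))
  exact Subtype.ext (sub_eq_zero.1 (norm_eq_zero.1 h6))

/-- Compact subsets of the limit in the Hausdorff complementary topology are eventually contained
in the approximating sets. -/
theorem eventually_subset_of_tendsto_hausdorffComplDist {D Ω K : Set (Rn n)}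
    {Ωk : ℕ → Set (Rn n)} (hΩ : IsOpen Ω) (hΩD : Ω ⊆ D)
    (hH : Tendsto (fun k => hausdorffComplDist D (Ωk k) Ω) atTop (𝓝 0)) (hK : IsCompact K)
    (hKΩ : K ⊆ Ω) : ∀ᶠ k in atTop, K ⊆ Ωk k := by
  have hcl : IsClosed (closure D \ Ω) := isClosed_closure.sdiff hΩ
  have hdisj : Disjoint K (closure D \ Ω) :=
    Set.disjoint_left.2 fun x hx hx' => hx'.2 (hKΩ hx)
  obtain ⟨r, hr, h⟩ := Metric.exists_pos_forall_lt_edist hK hcl hdisj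
  have hr' : (0 : ℝ≥0∞) < r := by exact_mod_cast hr
  filter_upwards [hH.eventually_lt_const hr'] with k hk x hx
  by_contra hxk
  have hxD : x ∈ closure D \ Ωk k := ⟨subset_closure (hΩD (hKΩ hx)), hxk⟩
  obtain ⟨y, hy, hxy⟩ := Metric.exists_edist_lt_of_hausdorffEDist_lt hxD hk
  exact absurd hxy (not_lt.2 (h x hx y hy).le)

/-- The weak limit of the Dirichlet solutions minimises the energy. -/
theorem energy_le_of_weakTendsto {D Ω : Set (Rn n)} {Ωk : ℕ → Set (Rn n)} (hΩ : IsOpen Ω)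
    (hΩD : Ω ⊆ D) (hH : Tendsto (fun k => hausdorffComplDist D (Ωk k) Ω) atTop (𝓝 0))
    {f : StrongDual ℝ (W0 n s p D)} {u : ℕ → W0 n s p D}
    (hu : ∀ k, IsDirichletSolution f (Ωk k) (u k)) {v : W0 n s p D} (hv : WeakTendsto u v)
    {w : W0 n s p D} (hw : (w : Sobolev n s p) ∈ W0 n s p Ω) : energy f v ≤ energy f w := by
  have htest : ∀ g : W0 n s p D, (g : Sobolev n s p) ∈ testSubmodule n s p Ω →
      energy f v ≤ energy f g := by
    rintro g ⟨φ, ⟨h1, h2, h3⟩, h4⟩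
    have hconv : Convex ℝ {x | energy f x ≤ energy f g} := by
      simpa using (convexOn_energy f).convex_le (energy f g)
    refine hv.mem_of_convex hconv (isClosed_le (continuous_energy f) continuous_const) ?_
    filter_upwards [eventually_subset_of_tendsto_hausdorffComplDist hΩ hΩD hH h2.isCompact h3]
      with k hk
    exact (hu k).energy_le (Submodule.le_topologicalClosure _ ⟨φ, ⟨h1, h2, hk⟩, h4⟩)
  have hw' := hw
  rw [W0, ← SetLike.mem_coe, Submodule.topologicalClosure_coe, mem_closure_iff_seq_limit] at hw'
  obtain ⟨g, hg, hgw⟩ := hw'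
  have hgD : ∀ k, g k ∈ W0 n s p D := fun k =>
    W0_mono hΩD (Submodule.le_topologicalClosure _ (hg k))
  have hlim : Tendsto (fun k => (⟨g k, hgD k⟩ : W0 n s p D)) atTop (𝓝 w) :=
    tendsto_subtype_rng.2 hgw
  exact ge_of_tendsto' (((continuous_energy f).tendsto w).comp hlim) fun k => htest _ (hg k)

end Energy

end FracSob

theorem theorem3p5 (n : ℕ) (hn : 1 ≤ n) (s p : ℝ) (hs0 : 0 < s) (hs1 : s < 1) [Fact (1 < p)]
    (D : Set (FracSob.Rn n)) (hDo : IsOpen D) (hDb : Bornology.IsBounded D)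
    (f : StrongDual ℝ (FracSob.W0 n s p D))
    (Ωk : ℕ → Set (FracSob.Rn n)) (Ω : Set (FracSob.Rn n))
    (hΩko : ∀ k, IsOpen (Ωk k)) (hΩkD : ∀ k, Ωk k ⊆ D) (hΩo : IsOpen Ω) (hΩD : Ω ⊆ D)
    (hH : Tendsto (fun k => FracSob.hausdorffComplDist D (Ωk k) Ω) atTop (𝓝 0))
    (uk : ℕ → FracSob.W0 n s p D) (huk : ∀ k, FracSob.IsDirichletSolution f (Ωk k) (uk k))
    (hweak : ∃ ustar : FracSob.W0 n s p D, FracSob.WeakTendsto uk ustar)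
    (hcap : Tendsto (fun k => FracSob.relCap n s p (Ωk k \ Ω) D) atTop (𝓝 0)) :
    (∃! u : FracSob.W0 n s p D, FracSob.IsDirichletSolution f Ω u) ∧
      ∀ u : FracSob.W0 n s p D, FracSob.IsDirichletSolution f Ω u →
        FracSob.WeakTendsto uk u := by
  obtain ⟨v, hv⟩ := hweak
  have hvΩ := FracSob.mem_W0_of_weakTendsto hn hs0 hDo hDb hΩo hΩD (fun k => (huk k).1) hv hcap
  have hsol : FracSob.IsDirichletSolution f Ω v :=
    FracSob.isDirichletSolution_of_energy_le hvΩ fun w hw =>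
      FracSob.energy_le_of_weakTendsto hΩo hΩD hH huk hv hw
  refine ⟨⟨v, hsol, fun u hu => hu.unique hn hs0 hDb hsol⟩, fun u hu => ?_⟩
  rwa [hu.unique hn hs0 hDb hsol]
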